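/- **Setting.** Write $[A]$ for the convex hull of $A$, and $[P,z]=[P\cup\{z\}]$ for a polytope $P$ and a point $z$. A $d$-polytope in $\mathbb E^d$ is the convex hull of a finite set that affinely spans $\mathbb E^d$; its faces are $\emptyset$, itself, and its intersections with supporting hyperplanes; $\mathcal V(P)$ is its set of vertices. Let $m>1$ and let $P\subset\mathbb E^{2m}$ be a neighbourly $2m$-polytope (the convex hull of any $m$ vertices is a proper face) with at least $2m+3$ vertices. A $k$-face $U$ of $P$, $k$ odd, is *universal* if $[S\cup U]$ is a face of $P$ for every $S\subseteq\mathcal V(P)$ with $|S|\le\lfloor(2m-k-1)/2\rfloor$. Let $x_1,\dots,x_m,y_1,\dots,y_m$ be distinct vertices of $P$, put $\Phi_0=\emptyset$ and $\Phi_j=[\Phi_{j-1}\cup\{x_j,y_j\}]$, and assume that $\Phi_j$ is a universal $(2j-1)$-face of $P$ for $1\le j\le m$ (a universal tower). Given a full-dimensional polytope $R$ and an increasing chain $\Psi_1\subset\dots\subset\Psi_r$ of faces of $R$ ($r\ge 0$), let $\mathscr F_0$ be the set of all facets of $R$ (a point has none), let $\mathscr F_j$ be the set of facets containing $\Psi_j$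 for $1\le j\le r$, let $\mathscr F_j=\emptyset$ for $j>r$, and let $\mathcal C=(\mathscr F_1\setminus\mathscr F_2)\cup(\mathscr F_3\setminus\mathscr F_4)\cup\cdots$. A point $z$ *lies exactly beyond the chain* if $\operatorname{aff}F$ strictly separates $z$ from $R$ for every $F\in\mathcal C$, while $z$ lies strictly on the same side of $\operatorname{aff}F$ as $R$ for every other facet $F$. Then $[R,z]$ is said to be obtained from $R$ by sewing $z$ through the chain. For a face $G$ of a polytope $R$, the quotient $R/G$ is a polytope whose face lattice is identified, by a fixed isomorphism, with the interval $[G,R]$ of the face lattice of $R$; a face $A\supseteq G$ of $R$ corresponds to a face of $R/G$. The vertex of $R/G$ corresponding to $v\in\mathcal V(R)\setminus\mathcal V(G)$ is the vertex (when there is one) that corresponds to the least face of $R$ containing $G$ and $v$. **Theorem 3.1.** Let $\bar x$ lie exactly beyond the chain $\Phi_1,\dots,\Phi_m$ of $P$, let $P^+=[P,\bar x]$, and let $1\le i\le m$. Then $\Phi_i$ is a face of $P$ and $[\Phi_{i-1}\cup\{x_i,\bar x\}]$ is a face of $P^+$. Let $P/\Phi_i$ and $P^+/[\Phi_{i-1}\cup\{x_i,\bar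 x\}]$ be any realizations in $\mathbb E^{2m-2i}$, as $(2m-2i)$-polytopes, of these quotients, and write $v^*$ and $v^{**}$ for the vertices corresponding to $v$ in the first and in the second. Let $\Phi_{i+1}^*,\dots,\Phi_m^*$ be the faces of $P/\Phi_i$ corresponding to $\Phi_{i+1},\dots,\Phi_m$, let $\bar y^*\in\mathbb E^{2m-2i}$ lie exactly beyond this chain, and let $(P/\Phi_i)^+=[P/\Phi_i,\bar y^*]$. Then $$(P/\Phi_i)^+\;\cong\;P^+/[\Phi_{i-1}\cup\{x_i,\bar x\}]$$ combinatorially. More precisely, for each $v\in\mathcal V(P)\setminus\mathcal V(\Phi_i)$ the vertices $v^*$ and $v^{**}$ exist, $y_i^{**}$ exists, the vertices of $(P/\Phi_i)^+$ are exactly these $v^*$ together with $\bar y^*$ (pairwise distinct if $i<m$; for $i=m$ both polytopes are single points), and there is an isomorphism of face lattices inducing the bijection of vertices $$v^*\mapsto v^{**}\quad(v\in\mathcal V(P)\setminus\mathcal V(\Phi_i)),\qquad \bar y^*\mapsto y_i^{**}.$$ -/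

import Mathlib

namespace Sewing

/-- Euclidean `d`-space. -/
abbrev Euc (d : ℕ) : Type := EuclideanSpace ℝ (Fin d)

/-- `P` is a `d`-dimensional convex polytope in Euclidean `d`-space: the convex hull of a finite
point set whose affine hull is the whole space. -/
def IsFullPolytope {d : ℕ} (P : Set (Euc d)) : Prop :=
  (∃ s : Finset (Euc d), P = convexHull ℝ (s : Set (Euc d))) ∧ affineSpan ℝ P = ⊤

/-- Faces: the empty face, `P` itself, and the intersections of `P` with supporting hyperplanes
(the functional `0` gives `P`). -/
def IsFace {d : ℕ} (P F : Set (Euc d)) : Prop := IsExposed ℝ P F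

/-- The faces of `P`, ordered by inclusion: the face lattice. -/
abbrev Face {d : ℕ} (P : Set (Euc d)) : Type := {F : Set (Euc d) // IsFace P F}

/-- The vertices: the points that form a `0`-dimensional face. -/
def vertices {d : ℕ} (P : Set (Euc d)) : Set (Euc d) := {v | IsFace P {v}}

/-- The dimension of the affine hull of a nonempty set. -/
noncomputable def dim {d : ℕ} (A : Set (Euc d)) : ℕ := Module.finrank ℝ (vectorSpan ℝ A)

/-- The facets: nonempty faces of codimension one. -/
def facets {d : ℕ} (P : Set (Euc d)) : Set (Set (Euc d)) :=
  {F | IsFace P F ∧ F.Nonempty ∧ dim F + 1 = dim P}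

/-- A `d`-polytope is neighbourly if every `⌊d/2⌋` of its vertices determine (have as their
convex hull) a proper face. -/
def IsNeighbourly {d : ℕ} (P : Set (Euc d)) : Prop :=
  ∀ S : Finset (Euc d), (S : Set (Euc d)) ⊆ vertices P → S.card = d / 2 →
    IsFace P (convexHull ℝ (S : Set (Euc d))) ∧ convexHull ℝ (S : Set (Euc d)) ≠ P

/-- `U` is a universal `k`-face of the `d`-polytope `P`: the convex hull of `U` with any
at most `⌊(d - k - 1)/2⌋` vertices of `P` is a face of `P`. -/
def IsUniversalFace {d : ℕ} (P : Set (Euc d)) (k : ℕ) (U : Set (Euc d)) : Prop :=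
  IsFace P U ∧ U.Nonempty ∧ dim U = k ∧
    ∀ S : Finset (Euc d), (S : Set (Euc d)) ⊆ vertices P → S.card ≤ (d - k - 1) / 2 →
      IsFace P (convexHull ℝ ((S : Set (Euc d)) ∪ U))

/-- `Φ_0 = ∅` and `Φ_j = [Φ_{j-1}, x_j, y_j]` for `j ≥ 1`. -/
def towerFace {d : ℕ} (x y : ℕ → Euc d) : ℕ → Set (Euc d)
  | 0 => ∅
  | j + 1 => convexHull ℝ (towerFace x y j ∪ {x (j + 1), y (j + 1)})

/-- `x_1, …, x_m, y_1, …, y_m` are distinct vertices of `P` and each `Φ_j`, `1 ≤ j ≤ m`, is a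
universal `(2j-1)`-face of `P`. Values of `x` and `y` at other indices play no role. -/
structure IsUniversalTower {d : ℕ} (P : Set (Euc d)) (m : ℕ) (x y : ℕ → Euc d) : Prop where
  x_mem : ∀ j ∈ Set.Icc 1 m, x j ∈ vertices P
  y_mem : ∀ j ∈ Set.Icc 1 m, y j ∈ vertices P
  x_inj : Set.InjOn x (Set.Icc 1 m)
  y_inj : Set.InjOn y (Set.Icc 1 m)
  x_ne_y : ∀ j ∈ Set.Icc 1 m, ∀ k ∈ Set.Icc 1 m, x j ≠ y k
  universal : ∀ j ∈ Set.Icc 1 m, IsUniversalFace P (2 * j - 1) (towerFace x y j)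

/-- For a chain `Φ_1, …, Φ_m`: the facets of `P` containing `Φ_j`, where `j = 0` gives all facets
and `j > m` gives none. -/
def towerFacets {d : ℕ} (P : Set (Euc d)) (m : ℕ) (Φ : ℕ → Set (Euc d)) (j : ℕ) :
    Set (Set (Euc d)) :=
  {F | F ∈ facets P ∧ j ≤ m ∧ (1 ≤ j → Φ j ⊆ F)}

/-- `(𝓕_1 \ 𝓕_2) ∪ (𝓕_3 \ 𝓕_4) ∪ …` -/
def beyondFacets {d : ℕ} (P : Set (Euc d)) (m : ℕ) (Φ : ℕ → Set (Euc d)) : Set (Set (Euc d)) :=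
  ⋃ k : ℕ, towerFacets P m Φ (2 * k + 1) \ towerFacets P m Φ (2 * k + 2)

/-- The hyperplane `aff F` strictly separates the point `z` from `P`. -/
def IsBeyond {d : ℕ} (P F : Set (Euc d)) (z : Euc d) : Prop :=
  ∃ (l : Euc d →ₗ[ℝ] ℝ) (c : ℝ), (∀ w, w ∈ affineSpan ℝ F ↔ l w = c) ∧ (∀ p ∈ P, l p ≤ c) ∧ c < l z

/-- The point `z` lies off the hyperplane `aff F`, strictly on the same side as `P`. -/
def IsBeneath {d : ℕ} (P F : Set (Euc d)) (z : Euc d) : Prop :=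
  ∃ (l : Euc d →ₗ[ℝ] ℝ) (c : ℝ), (∀ w, w ∈ affineSpan ℝ F ↔ l w = c) ∧ (∀ p ∈ P, l p ≤ c) ∧ l z < c

/-- `z` lies exactly beyond the set of facets determined by the chain `Φ_1, …, Φ_m`. -/
def IsExactlyBeyond {d : ℕ} (P : Set (Euc d)) (m : ℕ) (Φ : ℕ → Set (Euc d)) (z : Euc d) : Prop :=
  (∀ F ∈ beyondFacets P m Φ, IsBeyond P F z) ∧
    ∀ F ∈ facets P \ beyondFacets P m Φ, IsBeneath P F z

/-- `[P, z]`. -/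
def sewn {d : ℕ} (P : Set (Euc d)) (z : Euc d) : Set (Euc d) := convexHull ℝ (insert z P)

/-- A realization, as an `e`-polytope in Euclidean `e`-space, of the quotient polytope `P/G` of
`P` by its face `G`: a polytope together with an isomorphism of its face lattice onto the
interval `[G, P]` of the face lattice of `P`. -/
structure QuotientPolytope {d : ℕ} (P : Set (Euc d)) (G : Face P) (e : ℕ) where
  carrier : Set (Euc e)
  isFullPolytope : IsFullPolytope carrier
  faceIso : Face carrier ≃o Set.Ici G

/-- The face `A*` of the quotient polytope that corresponds to the face `A ⊇ G` of `P`. -/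
def QuotientPolytope.star {d : ℕ} {P : Set (Euc d)} {G : Face P} {e : ℕ}
    (Q : QuotientPolytope P G e) (A : Set (Euc d)) : Set (Euc e) :=
  {q | ∃ f : Face Q.carrier, (Q.faceIso f).1.1 = A ∧ q ∈ f.1}

/-- `p` is the vertex of the quotient polytope that corresponds to the point `v` of `P`: the face
`{p}` of the quotient corresponds to the least face of `P` that contains both `G` and `v`. -/
def QuotientPolytope.IsStarVertex {d : ℕ} {P : Set (Euc d)} {G : Face P} {e : ℕ}
    (Q : QuotientPolytope P G e) (v : Euc d) (p : Euc e) : Prop :=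
  ∃ f : Face Q.carrier, f.1 = {p} ∧ IsLeast {F : Face P | G ≤ F ∧ v ∈ F.1} (Q.faceIso f).1

/-- `φ` restricts to a bijection between the vertices of `P` and of `Q` that is induced by an
isomorphism of the face lattices. -/
def IsCombinatorialIso {d e : ℕ} (P : Set (Euc d)) (Q : Set (Euc e)) (φ : Euc d → Euc e) : Prop :=
  Set.BijOn φ (vertices P) (vertices Q) ∧
    ∃ ψ : Face P ≃o Face Q, ∀ F : Face P, (ψ F).1 ∩ vertices Q = φ '' (F.1 ∩ vertices P)

end Sewing

/-! For the tower `Φ`, the point `z` lies beyond or beneath a facet `F` of `P` according to the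
parity of the level of `F`, the largest `j` with `Φ_j ⊆ F`. As `P` is simplicial, the proper faces
of `[P, z]` through `z` correspond to the vertex sets `A` lying both in a facet of odd and in a
facet of even level. Passing to `P/Φ_i` lowers all levels by `i`, which at most exchanges the two
parities. Coding a face of `[P/Φ_i, w]` by the vertices of `P` in its trace, with `y_i` in the code
exactly when `w` is in the face, embeds this face lattice in the sets of vertices of `P`. Its image
consists of the sets coding the faces of `[P, z]` that contain `Φ_{i-1}`, `x_i` and `z`, so both
lattices are isomorphic, with `w` and `y_i` corresponding to each other. -/

namespace Sewing

open Set Filter Topology MeasureTheory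

section Polytope

variable {d : ℕ} {R F E : Set (Euc d)} {l : Euc d →ₗ[ℝ] ℝ} {c : ℝ}

theorem IsFace.exists_functional (hF : IsFace R F) (hne : F.Nonempty) :
    ∃ (l : Euc d →ₗ[ℝ] ℝ) (c : ℝ), (∀ p ∈ R, l p ≤ c) ∧ F = {p ∈ R | l p = c} := by
  obtain ⟨l, hl⟩ := hF hne
  obtain ⟨x₀, hx₀⟩ := hne
  have hmax : ∀ p ∈ R, l p ≤ l x₀ := by
    rw [hl] at hx₀
    exact hx₀.2
  refine ⟨l, l x₀, hmax, ?_⟩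
  conv_lhs => rw [hl]
  ext p
  refine ⟨fun ⟨hp, h⟩ => ⟨hp, le_antisymm (hmax p hp) (h _ (hF.subset hx₀))⟩,
    fun ⟨hp, h⟩ => ⟨hp, fun q hq => ?_⟩⟩
  change l p = l x₀ at h
  exact h ▸ hmax q hq

theorem isFace_setOf (l : Euc d →ₗ[ℝ] ℝ) (c : ℝ) (h : ∀ p ∈ R, l p ≤ c) :
    IsFace R {p ∈ R | l p = c} := by
  rintro ⟨x₀, hx₀, h₀⟩
  refine ⟨LinearMap.toContinuousLinearMap l, ?_⟩
  ext p
  simp only [mem_ofPred_eq, LinearMap.coe_toContinuousLinearMap']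
  exact ⟨fun ⟨hp, hpc⟩ => ⟨hp, fun q hq => hpc ▸ h q hq⟩,
    fun ⟨hp, hpc⟩ => ⟨hp, le_antisymm (h p hp) (h₀ ▸ hpc x₀ hx₀)⟩⟩

theorem vectorSpan_le_ker (hF : ∀ p ∈ F, l p = c) : vectorSpan ℝ F ≤ LinearMap.ker l := by
  rw [vectorSpan_def, Submodule.span_le]
  rintro _ ⟨a, ha, b, hb, rfl⟩
  simp [hF a ha, hF b hb]

theorem eq_of_mem_affineSpan (hF : ∀ p ∈ F, l p = c) {w : Euc d} (hw : w ∈ affineSpan ℝ F) :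
    l w = c := by
  obtain ⟨p₀, hp₀⟩ := (affineSpan_nonempty ℝ).1 ⟨w, hw⟩
  have h : w -ᵥ p₀ ∈ vectorSpan ℝ F := by
    rw [← direction_affineSpan]
    exact AffineSubspace.vsub_mem_direction hw (mem_affineSpan ℝ hp₀)
  have := vectorSpan_le_ker hF h
  rwa [LinearMap.mem_ker, vsub_eq_sub, map_sub, hF p₀ hp₀, sub_eq_zero] at this

theorem finrank_ker_add_one (hl : l ≠ 0) : Module.finrank ℝ (LinearMap.ker l) + 1 = d := by
  have hk : Module.finrank ℝ (LinearMap.ker l) + 1 = Module.finrank ℝ (Euc d) :=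
    Module.Dual.finrank_ker_add_one_of_ne_zero hl
  rwa [finrank_euclideanSpace_fin] at hk

theorem dim_add_one_le (hl : l ≠ 0) (hF : ∀ p ∈ F, l p = c) : dim F + 1 ≤ d :=
  (Nat.add_le_add_right (Submodule.finrank_mono (vectorSpan_le_ker hF)) 1).trans_eq
    (finrank_ker_add_one hl)

theorem mem_affineSpan_iff_of_le_dim (hl : l ≠ 0) (hne : F.Nonempty) (hF : ∀ p ∈ F, l p = c)
    (hdim : d ≤ dim F + 1) (w : Euc d) : w ∈ affineSpan ℝ F ↔ l w = c := by
  obtain ⟨p₀, hp₀⟩ := hne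
  have heq : vectorSpan ℝ F = LinearMap.ker l := by
    apply Submodule.eq_of_le_of_finrank_le (vectorSpan_le_ker hF)
    have := finrank_ker_add_one hl
    unfold dim at hdim
    omega
  rw [← AffineSubspace.vsub_right_mem_direction_iff_mem (mem_affineSpan ℝ hp₀),
    direction_affineSpan, heq, LinearMap.mem_ker, vsub_eq_sub, map_sub, hF p₀ hp₀, sub_eq_zero]

namespace IsFullPolytope

theorem convex (hR : IsFullPolytope R) : Convex ℝ R := by
  obtain ⟨⟨s, rfl⟩, -⟩ := hR
  exact convex_convexHull ℝ _

theorem isCompact (hR : IsFullPolytope R) : IsCompact R := by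
  obtain ⟨⟨s, rfl⟩, -⟩ := hR
  exact s.finite_toSet.isCompact_convexHull (𝕜 := ℝ)

theorem interior_nonempty (hR : IsFullPolytope R) : (interior R).Nonempty :=
  (Convex.interior_nonempty_iff_affineSpan_eq_top hR.convex).2 hR.2

theorem nonempty (hR : IsFullPolytope R) : R.Nonempty := hR.interior_nonempty.mono interior_subset

theorem dim_eq (hR : IsFullPolytope R) : dim R = d := by
  unfold dim
  rw [← direction_affineSpan, hR.2, AffineSubspace.direction_top, finrank_top,
    finrank_euclideanSpace_fin]

end IsFullPolytope

theorem IsFace.eq_convexHull_inter {S : Set (Euc d)} (hE : IsFace (convexHull ℝ S) E) :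
    E = convexHull ℝ (E ∩ S) := by
  refine Subset.antisymm ?_
    (convexHull_min inter_subset_left (hE.convex (convex_convexHull ℝ S)))
  rcases E.eq_empty_or_nonempty with rfl | hne
  · exact empty_subset _
  obtain ⟨l, c, hle, hEeq⟩ := hE.exists_functional hne
  set T : Set (Euc d) := {w | l w ≤ c ∧ (l w = c → w ∈ convexHull ℝ (E ∩ S))}
  have hTc : Convex ℝ T := by
    rw [convex_iff_forall_pos]
    rintro x ⟨hx₁, hx₂⟩ y ⟨hy₁, hy₂⟩ a b ha hb hab
    have hlin : l (a • x + b • y) = a * l x + b * l y := by simp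
    have hac : a * c + b * c = c := by rw [← add_mul, hab, one_mul]
    have hax := mul_le_mul_of_nonneg_left hx₁ ha.le
    have hby := mul_le_mul_of_nonneg_left hy₁ hb.le
    refine ⟨by linarith, fun h => ?_⟩
    have hx : l x = c := hx₁.antisymm (le_of_mul_le_mul_left (by linarith) ha)
    have hy : l y = c := hy₁.antisymm (le_of_mul_le_mul_left (by linarith) hb)
    exact convex_convexHull ℝ _ (hx₂ hx) (hy₂ hy) ha.le hb.le hab
  have hST : S ⊆ T := fun p hp =>
    have hpS := subset_convexHull ℝ S hp
    ⟨hle p hpS, fun h => subset_convexHull ℝ _ ⟨hEeq ▸ ⟨hpS, h⟩, hp⟩⟩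
  intro w hw
  refine (convexHull_min hST hTc (hE.subset hw)).2 ?_
  rw [hEeq] at hw
  exact hw.2

theorem IsFullPolytope.finite_faces (hR : IsFullPolytope R) : {F | IsFace R F}.Finite := by
  obtain ⟨⟨s, rfl⟩, -⟩ := hR
  exact (s.finite_toSet.finite_subsets.image fun A => convexHull ℝ A).subset fun F hF =>
    ⟨F ∩ s, inter_subset_right, hF.eq_convexHull_inter.symm⟩

theorem IsFullPolytope.finite_facets (hR : IsFullPolytope R) : (facets R).Finite :=
  hR.finite_faces.subset fun _ h => h.1

theorem exists_mem_forall_notMem_affineSubspace {U : Set (Euc d)} (hU : IsOpen U)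
    (hne : U.Nonempty) {S : Set (AffineSubspace ℝ (Euc d))} (hS : S.Finite)
    (htop : ∀ A ∈ S, A ≠ ⊤) : ∃ o ∈ U, ∀ A ∈ S, o ∉ A := by
  by_contra! hcov
  have hnull : volume (⋃ A ∈ S, (A : Set (Euc d))) = 0 :=
    (measure_biUnion_null_iff hS.countable).2 fun A hA =>
      Measure.addHaar_affineSubspace volume A (htop A hA)
  exact (hU.measure_pos volume hne).ne'
    (measure_mono_null (fun o ho => by simpa using hcov o ho) hnull)

theorem exists_mem_segment_mem_frontier {o w : Euc d} (ho : o ∈ interior R) (hw : w ∉ R) :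
    ∃ p ∈ segment ℝ o w, p ∈ frontier R := by
  by_contra! h
  have hcov : segment ℝ o w ⊆ interior R ∪ (closure R)ᶜ := fun p hp => by
    by_contra hp'
    rw [mem_union, not_or, notMem_compl_iff] at hp'
    exact h p hp ⟨hp'.2, hp'.1⟩
  have hw' : w ∈ (closure R)ᶜ := (hcov (right_mem_segment ℝ o w)).resolve_left fun h' =>
    hw (interior_subset h')
  obtain ⟨p, -, hp, hp'⟩ := (convex_segment o w).isPreconnected _ _ isOpen_interior
    isClosed_closure.isOpen_compl hcov ⟨o, left_mem_segment ℝ o w, ho⟩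
    ⟨w, right_mem_segment ℝ o w, hw'⟩
  exact hp' (interior_subset_closure hp)

theorem IsFullPolytope.exists_functional_of_notMem_interior (hR : IsFullPolytope R) {p : Euc d}
    (hp : p ∉ interior R) : ∃ l : Euc d →ₗ[ℝ] ℝ,
      l ≠ 0 ∧ (∀ q ∈ R, l q ≤ l p) ∧ ∀ q ∈ interior R, l q < l p := by
  obtain ⟨f, hf⟩ := geometric_hahn_banach_open_point hR.convex.interior isOpen_interior hp
  refine ⟨f, ?_, fun q hq => ?_, hf⟩
  · intro h
    obtain ⟨o, ho⟩ := hR.interior_nonempty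
    have hzero : ∀ q, f q = 0 := LinearMap.congr_fun h
    simpa [hzero] using hf o ho
  · apply closure_minimal (fun x hx => (hf x hx).le) (isClosed_Iic.preimage f.continuous)
    rw [hR.convex.closure_interior_eq_closure_of_nonempty_interior hR.interior_nonempty]
    exact subset_closure hq

/-- The segment from `w` to a generic interior point `o` enters `R` through the relative interior
of a facet: a face met there spans the space together with `w`, by the genericity of `o`. -/
theorem IsFullPolytope.exists_isBeyond (hR : IsFullPolytope R) {w : Euc d} (hw : w ∉ R) :
    ∃ F ∈ facets R, IsBeyond R F w := by
  have hfin : {A | A ≠ ⊤ ∧ ∃ F, IsFace R F ∧ affineSpan ℝ (insert w F) = A}.Finite :=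
    (hR.finite_faces.image fun F => affineSpan ℝ (insert w F)).subset fun _ hA => hA.2
  obtain ⟨o, ho, hgen⟩ := exists_mem_forall_notMem_affineSubspace isOpen_interior
    hR.interior_nonempty hfin fun _ hA => hA.1
  obtain ⟨p, ⟨a, b, ha, hb, hab, hp_eq⟩, hp⟩ := exists_mem_segment_mem_frontier ho hw
  obtain rfl : b = 1 - a := by linarith
  have hpR : p ∈ R := hR.isCompact.isClosed.frontier_subset hp
  obtain ⟨l, hl, hle, hlt⟩ := hR.exists_functional_of_notMem_interior hp.2
  have ha₀ : a ≠ 0 := by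
    rintro rfl
    exact hw (by simpa [← hp_eq] using hpR)
  set F : Set (Euc d) := {q ∈ R | l q = l p}
  have hF : IsFace R F := isFace_setOf l (l p) hle
  have hpF : p ∈ F := ⟨hpR, rfl⟩
  have hlF : ∀ q ∈ F, l q = l p := fun q hq => hq.2
  have hwp : l p < l w := by
    have hlp : l p = a * l o + (1 - a) * l w := by simp [← hp_eq]
    have := mul_lt_mul_of_pos_left (hlt o ho) (ha.lt_of_ne' ha₀)
    exact lt_of_mul_lt_mul_left (by linarith) hb
  have hspan : affineSpan ℝ (insert w F) = ⊤ := by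
    by_contra hne
    refine hgen _ ⟨hne, F, hF, rfl⟩ ?_
    have ho_eq : AffineMap.lineMap w p a⁻¹ = o := by
      have h : a⁻¹ * (1 - a) = a⁻¹ - 1 := by field_simp
      rw [AffineMap.lineMap_apply_module, ← hp_eq, smul_add, smul_smul, smul_smul,
        inv_mul_cancel₀ ha₀, h]
      module
    rw [← ho_eq]
    exact AffineMap.lineMap_mem _ (mem_affineSpan ℝ (mem_insert w F))
      (mem_affineSpan ℝ (mem_insert_of_mem w hpF))
  have hdim : d ≤ dim F + 1 := by
    have := finrank_vectorSpan_insert_le_set ℝ F w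
    rwa [← direction_affineSpan, hspan, AffineSubspace.direction_top, finrank_top,
      finrank_euclideanSpace_fin] at this
  exact ⟨F, ⟨hF, ⟨p, hpF⟩, ((dim_add_one_le hl hlF).antisymm hdim).trans hR.dim_eq.symm⟩,
    l, l p, mem_affineSpan_iff_of_le_dim hl ⟨p, hpF⟩ hlF hdim, hle, hwp⟩

end Polytope

section Facets

variable {d : ℕ} {R F E C : Set (Euc d)} {l : Euc d →ₗ[ℝ] ℝ} {c : ℝ}

theorem eventually_add_mul_nonpos {a b : ℝ} (ha : a ≤ 0) (hb : a = 0 → b ≤ 0) :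
    ∀ᶠ ε in 𝓝[>] (0 : ℝ), a + ε * b ≤ 0 := by
  rcases ha.eq_or_lt with h | h
  · filter_upwards [self_mem_nhdsWithin] with ε hε
    rw [h, zero_add]
    exact mul_nonpos_of_nonneg_of_nonpos (le_of_lt hε) (hb h)
  · have hc : Tendsto (fun ε : ℝ => a + ε * b) (𝓝[>] 0) (𝓝 (a + 0 * b)) := by
      apply tendsto_nhdsWithin_of_tendsto_nhds
      exact Continuous.tendsto (by fun_prop) 0
    rw [zero_mul, add_zero] at hc
    filter_upwards [hc.eventually_lt_const h] with ε hε using hε.le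

theorem exists_pos_of_eventually {p : ℝ → Prop} (h : ∀ᶠ ε in 𝓝[>] (0 : ℝ), p ε) :
    ∃ ε > 0, p ε :=
  have ⟨ε, hε, hpos⟩ := (h.and self_mem_nhdsWithin).exists
  ⟨ε, hpos, hε⟩

/-- The hyperplane `l = c` is the affine hull of `F` and supports `R`. -/
def Supports (R F : Set (Euc d)) (l : Euc d →ₗ[ℝ] ℝ) (c : ℝ) : Prop :=
  (∀ w, w ∈ affineSpan ℝ F ↔ l w = c) ∧ ∀ p ∈ R, l p ≤ c

theorem Supports.mem_iff (h : Supports R F l c) (hF : F ∈ facets R) {p : Euc d} :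
    p ∈ F ↔ p ∈ R ∧ l p = c := by
  refine ⟨fun hp => ⟨hF.1.subset hp, (h.1 p).1 (mem_affineSpan ℝ hp)⟩, fun ⟨hp, hpc⟩ => ?_⟩
  obtain ⟨l', c', -, hF'⟩ := hF.1.exists_functional hF.2.1
  have hl' : ∀ q ∈ F, l' q = c' := fun q hq => by
    rw [hF'] at hq
    exact hq.2
  rw [hF']
  exact ⟨hp, eq_of_mem_affineSpan hl' ((h.1 p).2 hpc)⟩

theorem ne_of_mem_facets (hF : F ∈ facets R) : F ≠ R := by
  rintro rfl
  exact (Nat.succ_ne_self _) hF.2.2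

theorem Supports.exists_lt (h : Supports R F l c) (hF : F ∈ facets R) : ∃ r ∈ R, l r < c := by
  obtain ⟨r, hr, hrF⟩ := exists_of_ssubset (hF.1.subset.ssubset_of_ne (ne_of_mem_facets hF))
  exact ⟨r, hr, (h.2 r hr).lt_of_ne fun h' => hrF ((h.mem_iff hF).2 ⟨hr, h'⟩)⟩

theorem Supports.eq_iff {l' : Euc d →ₗ[ℝ] ℝ} {c' : ℝ} (h : Supports R F l c)
    (h' : Supports R F l' c') (w : Euc d) : l w = c ↔ l' w = c' :=
  (h.1 w).symm.trans (h'.1 w)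

theorem Supports.lt_of_lt {l' : Euc d →ₗ[ℝ] ℝ} {c' : ℝ} (h : Supports R F l c)
    (h' : Supports R F l' c') (hF : F ∈ facets R) {z : Euc d} (hz : c < l z) : c' < l' z := by
  by_contra hcon
  obtain ⟨r, hr, hlr⟩ := h.exists_lt hF
  have hl'z : l' z < c' := (not_lt.1 hcon).lt_of_ne fun e => hz.ne' ((h.eq_iff h' z).2 e)
  have hl'r : l' r < c' := (h'.2 r hr).lt_of_ne fun e => hlr.ne ((h.eq_iff h' r).2 e)
  -- the point of the segment from `r` to `z` on the hyperplane `l = c`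
  have hpos : 0 < l z - l r := by linarith
  set t : ℝ := (c - l r) / (l z - l r)
  have ht₀ : 0 < t := div_pos (by linarith) hpos
  have ht₁ : t < 1 := (div_lt_one hpos).2 (by linarith)
  have hlq : l ((1 - t) • r + t • z) = c := by
    have : t * (l z - l r) = c - l r := div_mul_cancel₀ _ hpos.ne'
    simp only [map_add, map_smul, smul_eq_mul]
    linarith
  have hl'q := (h.eq_iff h' _).1 hlq
  simp only [map_add, map_smul, smul_eq_mul] at hl'q
  nlinarith

theorem isBeyond_iff (h : Supports R F l c) (hF : F ∈ facets R) {z : Euc d} :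
    IsBeyond R F z ↔ c < l z :=
  ⟨fun ⟨_, _, h₁, h₂, h₃⟩ => Supports.lt_of_lt ⟨h₁, h₂⟩ h hF h₃, fun hz => ⟨l, c, h.1, h.2, hz⟩⟩

theorem isBeneath_iff (h : Supports R F l c) (hF : F ∈ facets R) {z : Euc d} :
    IsBeneath R F z ↔ l z < c := by
  refine ⟨fun ⟨l', c', h₁, h₂, h₃⟩ => ?_, fun hz => ⟨l, c, h.1, h.2, hz⟩⟩
  have h' : Supports R F l' c' := ⟨h₁, h₂⟩
  refine lt_of_le_of_ne (not_lt.1 fun hlt => h₃.not_gt (h.lt_of_lt h' hF hlt)) fun e => h₃.ne ?_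
  exact (h.eq_iff h' z).1 e

theorem IsBeyond.notMem {z : Euc d} (h : IsBeyond R F z) : z ∉ R := by
  obtain ⟨l, c, -, hle, hz⟩ := h
  exact fun hzR => (hle z hzR).not_gt hz

theorem IsBeyond.not_isBeneath {z : Euc d} (h : IsBeyond R F z) (hF : F ∈ facets R) :
    ¬IsBeneath R F z := by
  obtain ⟨l, c, h₁, h₂, h₃⟩ := h
  rw [isBeneath_iff ⟨h₁, h₂⟩ hF]
  exact h₃.not_gt

theorem IsFullPolytope.exists_supports (hR : IsFullPolytope R) (hF : F ∈ facets R) :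
    ∃ (l : Euc d →ₗ[ℝ] ℝ) (c : ℝ), Supports R F l c := by
  obtain ⟨l, c, hle, heq⟩ := hF.1.exists_functional hF.2.1
  refine ⟨l, c, mem_affineSpan_iff_of_le_dim ?_ hF.2.1 (fun p hp => ?_) ?_, hle⟩
  · rintro rfl
    obtain ⟨q, hq⟩ := hF.2.1
    rw [heq] at hq
    refine ne_of_mem_facets hF (hF.1.subset.antisymm fun r hr => ?_)
    rw [heq]
    exact ⟨hr, hq.2⟩
  · rw [heq] at hp
    exact hp.2
  · rw [hF.2.2, hR.dim_eq]

/-- A choice of supporting functionals for all facets. -/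
def FacetFunctionals (R : Set (Euc d)) (l : Set (Euc d) → Euc d →ₗ[ℝ] ℝ)
    (c : Set (Euc d) → ℝ) : Prop :=
  ∀ F ∈ facets R, Supports R F (l F) (c F)

theorem IsFullPolytope.exists_facetFunctionals (hR : IsFullPolytope R) :
    ∃ l c, FacetFunctionals R l c := by
  choose! l c h using fun F (hF : F ∈ facets R) => hR.exists_supports hF
  exact ⟨l, c, h⟩

theorem IsFullPolytope.mem_of_forall_le (hR : IsFullPolytope R)
    {l : Set (Euc d) → Euc d →ₗ[ℝ] ℝ} {c : Set (Euc d) → ℝ} (hl : FacetFunctionals R l c)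
    {w : Euc d} (hw : ∀ F ∈ facets R, l F w ≤ c F) : w ∈ R := by
  by_contra hwR
  obtain ⟨F, hF, hb⟩ := hR.exists_isBeyond hwR
  exact (hw F hF).not_gt ((isBeyond_iff (hl F hF) hF).1 hb)

theorem IsFullPolytope.eventually_add_smul_mem (hR : IsFullPolytope R)
    {l : Set (Euc d) → Euc d →ₗ[ℝ] ℝ} {c : Set (Euc d) → ℝ} (hl : FacetFunctionals R l c)
    {e u : Euc d} (he : e ∈ R) (hu : ∀ F ∈ facets R, e ∈ F → l F u ≤ 0) :
    ∀ᶠ ε in 𝓝[>] (0 : ℝ), e + ε • u ∈ R := by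
  have : ∀ᶠ ε in 𝓝[>] (0 : ℝ), ∀ F ∈ facets R, (l F e - c F) + ε * l F u ≤ 0 := by
    rw [eventually_all_finite hR.finite_facets]
    intro F hF
    refine eventually_add_mul_nonpos (sub_nonpos.2 ((hl F hF).2 e he)) fun h => ?_
    exact hu F hF (((hl F hF).mem_iff hF).2 ⟨he, by linarith⟩)
  filter_upwards [this] with ε hε
  refine hR.mem_of_forall_le hl fun F hF => ?_
  have := hε F hF
  simp only [map_add, map_smul, smul_eq_mul]
  linarith

theorem exists_mem_forall_subset_of_isExtreme (hC : Convex ℝ C) (hCR : C ⊆ R) (hne : C.Nonempty)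
    {T : Set (Set (Euc d))} (hT : T.Finite) (hext : ∀ F ∈ T, IsExtreme ℝ R F) :
    ∃ e ∈ C, ∀ F ∈ T, e ∈ F → C ⊆ F := by
  induction T, hT using Set.Finite.induction_on with
  | empty => exact ⟨hne.some, hne.some_mem, by simp⟩
  | @insert F₀ T _ _ ih =>
    obtain ⟨e, he, heT⟩ := ih fun F hF => hext F (mem_insert_of_mem F₀ hF)
    by_cases hCF₀ : C ⊆ F₀
    · exact ⟨e, he, forall_mem_insert.2 ⟨fun _ => hCF₀, heT⟩⟩
    obtain ⟨e₀, he₀, he₀F₀⟩ := not_subset.1 hCF₀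
    have hseg := midpoint_mem_openSegment (𝕜 := ℝ) e e₀
    refine ⟨_, hC.openSegment_subset he he₀ hseg, forall_mem_insert.2 ⟨fun hmem => ?_,
      fun F hF hmem => heT F hF ?_⟩⟩
    · exact absurd ((hext F₀ (mem_insert F₀ T)).right_mem_of_mem_openSegment (hCR he) (hCR he₀)
        hmem hseg) he₀F₀
    · exact (hext F (mem_insert_of_mem F₀ hF)).left_mem_of_mem_openSegment (hCR he) (hCR he₀)
        hmem hseg

theorem IsFullPolytope.exists_mem_forall_facet_subset (hR : IsFullPolytope R) (hC : Convex ℝ C)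
    (hCR : C ⊆ R) (hne : C.Nonempty) : ∃ e ∈ C, ∀ F ∈ facets R, e ∈ F → C ⊆ F :=
  exists_mem_forall_subset_of_isExtreme hC hCR hne hR.finite_facets fun _ hF => hF.1.isExtreme

theorem IsFullPolytope.exists_facet_pos (hR : IsFullPolytope R)
    {l : Set (Euc d) → Euc d →ₗ[ℝ] ℝ} {c : Set (Euc d) → ℝ} (hl : FacetFunctionals R l c)
    (hC : Convex ℝ C) (hCR : C ⊆ R) (hne : C.Nonempty) {l₀ : Euc d →ₗ[ℝ] ℝ} {c₀ : ℝ}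
    (hle : ∀ p ∈ R, l₀ p ≤ c₀) (heq : ∀ p ∈ C, l₀ p = c₀) {u : Euc d} (hu : 0 < l₀ u) :
    ∃ F ∈ facets R, C ⊆ F ∧ 0 < l F u := by
  by_contra! hcon
  obtain ⟨e, he, heF⟩ := hR.exists_mem_forall_facet_subset hC hCR hne
  obtain ⟨ε, hε, hmem⟩ := exists_pos_of_eventually <|
    hR.eventually_add_smul_mem hl (hCR he) fun F hF heF' => hcon F hF (heF F hF heF')
  have := hle _ hmem
  rw [map_add, map_smul, smul_eq_mul, heq e he] at this
  have := mul_pos hε hu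
  linarith

theorem IsFullPolytope.mem_of_forall_facet (hR : IsFullPolytope R) (hC : Convex ℝ C)
    (hext : IsExtreme ℝ R C) (hne : C.Nonempty) {w : Euc d} (hw : w ∈ R)
    (h : ∀ F ∈ facets R, C ⊆ F → w ∈ F) : w ∈ C := by
  obtain ⟨l, c, hl⟩ := hR.exists_facetFunctionals
  obtain ⟨e, he, heF⟩ := hR.exists_mem_forall_facet_subset hC hext.subset hne
  have heR := hext.subset he
  have hev := hR.eventually_add_smul_mem hl (u := e - w) heR fun F hF heF' => by
    have h1 := ((hl F hF).mem_iff hF).1 heF'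
    have h2 := ((hl F hF).mem_iff hF).1 (h F hF (heF F hF heF'))
    rw [map_sub, h1.2, h2.2, sub_self]
  obtain ⟨ε, hε, hmem⟩ := exists_pos_of_eventually hev
  refine hext.2 hw hmem he ?_
  have h1 : (1 + ε) ≠ 0 := by positivity
  refine ⟨ε / (1 + ε), 1 / (1 + ε), by positivity, by positivity, by field_simp; ring, ?_⟩
  have h2 : ε / (1 + ε) = 1 - 1 / (1 + ε) := by field_simp; ring
  have h3 : 1 / (1 + ε) * ε = 1 - 1 / (1 + ε) := by field_simp; ring
  rw [smul_add, smul_smul, h3, h2]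
  module

theorem IsFullPolytope.exists_facet_notMem (hR : IsFullPolytope R) (hE : IsFace R E)
    (hne : E.Nonempty) {w : Euc d} (hw : w ∈ R) (hwE : w ∉ E) :
    ∃ F ∈ facets R, E ⊆ F ∧ w ∉ F := by
  by_contra! h
  exact hwE (hR.mem_of_forall_facet (hE.convex hR.convex) hE.isExtreme hne hw h)

theorem IsFullPolytope.exists_facet_supset (hR : IsFullPolytope R) (hE : IsFace R E)
    (hne : E.Nonempty) (hER : E ≠ R) : ∃ F ∈ facets R, E ⊆ F := by
  obtain ⟨w, hw, hwE⟩ := exists_of_ssubset (hE.subset.ssubset_of_ne hER)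
  obtain ⟨F, hF, h, -⟩ := hR.exists_facet_notMem hE hne hw hwE
  exact ⟨F, hF, h⟩

theorem IsFullPolytope.isFace_of_isExtreme (hR : IsFullPolytope R) (hC : Convex ℝ C)
    (hext : IsExtreme ℝ R C) : IsFace R C := by
  classical
  rcases C.eq_empty_or_nonempty with rfl | hne
  · exact isExposed_empty
  obtain ⟨l, c, hl⟩ := hR.exists_facetFunctionals
  have hfin : {F | F ∈ facets R ∧ C ⊆ F}.Finite := hR.finite_facets.subset fun _ h => h.1
  have hmem : ∀ F ∈ hfin.toFinset, F ∈ facets R ∧ C ⊆ F := fun F hF => by simpa using hF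
  have hle : ∀ p ∈ R, ∀ F ∈ hfin.toFinset, l F p ≤ c F := fun p hp F hF =>
    (hl F (hmem F hF).1).2 p hp
  convert isFace_setOf (R := R) (∑ F ∈ hfin.toFinset, l F) (∑ F ∈ hfin.toFinset, c F) ?_ using 1
  · ext p
    simp only [mem_ofPred_eq, LinearMap.sum_apply]
    refine ⟨fun hp => ⟨hext.subset hp, Finset.sum_congr rfl fun F hF => ?_⟩, fun ⟨hp, hsum⟩ => ?_⟩
    · obtain ⟨hF, hCF⟩ := hmem F hF
      exact (((hl F hF).mem_iff hF).1 (hCF hp)).2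
    · refine hR.mem_of_forall_facet hC hext hne hp fun F hF hCF => ?_
      have := (Finset.sum_eq_sum_iff_of_le (hle p hp)).1 hsum F (by simpa using ⟨hF, hCF⟩)
      exact ((hl F hF).mem_iff hF).2 ⟨hp, this⟩
  · intro p hp
    rw [LinearMap.sum_apply]
    exact Finset.sum_le_sum (hle p hp)

theorem IsFullPolytope.vertices_eq (hR : IsFullPolytope R) : vertices R = R.extremePoints ℝ :=
  ext fun v => ⟨fun hv => isExtreme_singleton.1 (IsExposed.isExtreme hv),
    fun hv => hR.isFace_of_isExtreme (convex_singleton v) (isExtreme_singleton.2 hv)⟩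

theorem IsFullPolytope.finite_vertices (hR : IsFullPolytope R) : (vertices R).Finite :=
  Set.Finite.preimage (f := fun v : Euc d => ({v} : Set (Euc d)))
    Set.singleton_injective.injOn hR.finite_faces

theorem vertices_subset : vertices R ⊆ R := fun v (hv : IsFace R {v}) => hv.subset rfl

theorem IsFullPolytope.convexHull_vertices (hR : IsFullPolytope R) :
    convexHull ℝ (vertices R) = R := by
  have h := closure_convexHull_extremePoints hR.isCompact hR.convex
  rw [← hR.vertices_eq] at h
  rwa [(hR.finite_vertices.isCompact_convexHull (𝕜 := ℝ)).isClosed.closure_eq] at h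

theorem IsFullPolytope.convexHull_inter_vertices (hR : IsFullPolytope R)
    (hE : IsFace R E) : convexHull ℝ (E ∩ vertices R) = E := by
  have h := hE
  rw [← hR.convexHull_vertices] at h
  exact h.eq_convexHull_inter.symm

theorem IsFullPolytope.face_subset_iff (hR : IsFullPolytope R)
    (hE : IsFace R E) (hC : Convex ℝ C) : E ⊆ C ↔ ∀ v ∈ vertices R, v ∈ E → v ∈ C := by
  refine ⟨fun h v _ hv => h hv, fun h => ?_⟩
  rw [← hR.convexHull_inter_vertices hE]
  exact convexHull_min (fun v hv => h v hv.2 hv.1) hC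

theorem IsFullPolytope.exists_vertex_mem (hR : IsFullPolytope R)
    (hE : IsFace R E) (hne : E.Nonempty) : ∃ v ∈ vertices R, v ∈ E := by
  rw [← hR.convexHull_inter_vertices hE, convexHull_nonempty_iff] at hne
  obtain ⟨v, hv⟩ := hne
  exact ⟨v, hv.2, hv.1⟩

theorem IsFullPolytope.vertices_face (hR : IsFullPolytope R) (hE : IsFace R E) :
    vertices E = vertices R ∩ E := by
  ext v
  constructor
  · intro hv
    refine ⟨?_, vertices_subset hv⟩
    rw [hR.vertices_eq, ← isExtreme_singleton]
    exact hE.isExtreme.trans (IsExposed.isExtreme hv)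
  · rintro ⟨hv, hvE⟩
    exact IsExposed.mono hv hE.subset (singleton_subset_iff.2 hvE)

theorem IsFullPolytope.mem_of_mem_convexHull (hR : IsFullPolytope R)
    {A : Set (Euc d)} (hA : A ⊆ R) {v : Euc d} (hv : v ∈ vertices R)
    (hvA : v ∈ convexHull ℝ A) : v ∈ A := by
  rw [hR.vertices_eq] at hv
  have hsub : convexHull ℝ A ⊆ R := convexHull_min hA hR.convex
  exact extremePoints_convexHull_subset
    (inter_extremePoints_subset_extremePoints_of_subset hsub ⟨hvA, hv⟩)

theorem IsFullPolytope.facet_eq_of_subset (hR : IsFullPolytope R) {G : Set (Euc d)}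
    (hF : F ∈ facets R) (hG : G ∈ facets R) (hFG : F ⊆ G) : F = G := by
  obtain ⟨l, c, hl⟩ := hR.exists_supports hF
  obtain ⟨l', c', hl'⟩ := hR.exists_supports hG
  have hspan : affineSpan ℝ F = affineSpan ℝ G := by
    refine AffineSubspace.eq_of_direction_eq_of_nonempty_of_le ?_
      ((affineSpan_nonempty ℝ).2 hF.2.1) (affineSpan_mono ℝ hFG)
    rw [direction_affineSpan, direction_affineSpan]
    exact Submodule.eq_of_le_of_finrank_eq (vectorSpan_mono ℝ hFG)
      (Nat.succ_injective (hF.2.2.trans hG.2.2.symm))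
  ext p
  rw [hl.mem_iff hF, hl'.mem_iff hG, ← hl.1, ← hl'.1, hspan]

theorem IsFullPolytope.facets_nonempty (hR : IsFullPolytope R) (hd : 0 < d) :
    (facets R).Nonempty := by
  have : Nonempty (Fin d) := ⟨⟨0, hd⟩⟩
  obtain ⟨w, hw⟩ := (ne_univ_iff_exists_notMem R).1 hR.isCompact.ne_univ
  obtain ⟨F, hF, -⟩ := hR.exists_isBeyond hw
  exact ⟨F, hF⟩

theorem IsFullPolytope.mem_facets_iff (hR : IsFullPolytope R) (hd : 0 < d) :
    F ∈ facets R ↔ IsFace R F ∧ F ≠ R ∧ ∀ F', IsFace R F' → F ⊆ F' → F' ≠ R → F' ⊆ F := by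
  refine ⟨fun hF => ⟨hF.1, ne_of_mem_facets hF, fun F' hF' hsub hne => ?_⟩,
    fun ⟨hF, hne, hmax⟩ => ?_⟩
  · obtain ⟨G, hG, hF'G⟩ := hR.exists_facet_supset hF' (hF.2.1.mono hsub) hne
    rwa [hR.facet_eq_of_subset hF hG (hsub.trans hF'G)]
  · obtain ⟨G, hG, hFG⟩ : ∃ G ∈ facets R, F ⊆ G := by
      rcases F.eq_empty_or_nonempty with rfl | hFne
      · obtain ⟨G, hG⟩ := hR.facets_nonempty hd
        exact ⟨G, hG, empty_subset G⟩
      · exact hR.exists_facet_supset hF hFne hne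
    rwa [hFG.antisymm (hmax G hG.1 hFG (ne_of_mem_facets hG))]

end Facets

section Sewn

variable {d : ℕ} {R F E H C : Set (Euc d)} {z : Euc d}

theorem subset_sewn : R ⊆ sewn R z := (subset_insert z R).trans (subset_convexHull ℝ _)

theorem mem_sewn : z ∈ sewn R z := subset_convexHull ℝ _ (mem_insert z R)

theorem isFullPolytope_sewn (hR : IsFullPolytope R) (z : Euc d) : IsFullPolytope (sewn R z) := by
  classical
  obtain ⟨⟨s, rfl⟩, hspan⟩ := hR
  refine ⟨⟨insert z s, ?_⟩, top_unique (hspan.ge.trans (affineSpan_mono ℝ subset_sewn))⟩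
  rw [Finset.coe_insert, insert_eq z (s : Set (Euc d)), union_comm,
    ← convexHull_convexHull_union_left, union_comm, ← insert_eq]
  rfl

theorem le_on_sewn {l : Euc d →ₗ[ℝ] ℝ} {c : ℝ} (h : ∀ p ∈ R, l p ≤ c) (hz : l z ≤ c) :
    ∀ p ∈ sewn R z, l p ≤ c := fun _ hp =>
  convexHull_min (t := {p | l p ≤ c}) (insert_subset hz h) (convex_halfSpace_le l.isLinear c) hp

theorem IsFace.exists_functional_of_empty_or_nonempty (hE : IsFace R E) :
    ∃ (l : Euc d →ₗ[ℝ] ℝ) (c : ℝ), (∀ p ∈ R, l p ≤ c) ∧ E = {p ∈ R | l p = c} := by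
  rcases E.eq_empty_or_nonempty with rfl | hne
  · refine ⟨0, 1, fun p _ => by simp, ?_⟩
    ext p
    simp
  · exact hE.exists_functional hne

theorem setOf_sewn_inter (l : Euc d →ₗ[ℝ] ℝ) (c : ℝ) :
    {p ∈ sewn R z | l p = c} ∩ R = {p ∈ R | l p = c} :=
  ext fun _ => ⟨fun h => ⟨h.2, h.1.2⟩, fun h => ⟨⟨subset_sewn h.1, h.2⟩, h.1⟩⟩

theorem IsFace.inter_of_sewn (hH : IsFace (sewn R z) H) : IsFace R (H ∩ R) := by
  obtain ⟨l, c, hle, rfl⟩ := hH.exists_functional_of_empty_or_nonempty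
  rw [setOf_sewn_inter]
  exact isFace_setOf l c fun p hp => hle p (subset_sewn hp)

theorem IsFace.subset_iff_of_sewn (hH : IsFace (sewn R z) H) (hC : Convex ℝ C) :
    H ⊆ C ↔ (z ∈ H → z ∈ C) ∧ H ∩ R ⊆ C := by
  refine ⟨fun h => ⟨fun hz => h hz, inter_subset_left.trans h⟩, fun h => ?_⟩
  rw [IsFace.eq_convexHull_inter (S := insert z R) hH]
  refine convexHull_min ?_ hC
  rintro p ⟨hp, rfl | hpR⟩
  · exact h.1 hp
  · exact h.2 ⟨hp, hpR⟩

theorem IsFace.subset_of_sewn (hH : IsFace (sewn R z) H) (hR : Convex ℝ R) (hz : z ∉ H) :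
    H ⊆ R :=
  (hH.subset_iff_of_sewn hR).2 ⟨fun h => absurd h hz, inter_subset_right⟩

theorem setOf_add_smul_eq {l l' : Euc d →ₗ[ℝ] ℝ} {c c' t : ℝ} (h : ∀ p ∈ R, l p ≤ c)
    (h' : ∀ p ∈ R, l' p ≤ c') (heq : ∀ p ∈ R, l p = c → l' p = c') (ht : 0 ≤ t) :
    (∀ p ∈ R, (l + t • l') p ≤ c + t * c') ∧
      {p ∈ R | (l + t • l') p = c + t * c'} = {p ∈ R | l p = c} := by
  have ht' : ∀ p ∈ R, t * l' p ≤ t * c' := fun p hp => mul_le_mul_of_nonneg_left (h' p hp) ht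
  simp only [LinearMap.add_apply, LinearMap.smul_apply, smul_eq_mul]
  refine ⟨fun p hp => add_le_add (h p hp) (ht' p hp), ?_⟩
  ext p
  refine and_congr_right fun hp => ⟨fun hs => ?_, fun hs => by rw [hs, heq p hp hs]⟩
  exact le_antisymm (h p hp) (by linarith [ht' p hp])

theorem IsFullPolytope.exists_functional_add (hR : IsFullPolytope R) (hF : F ∈ facets R)
    (hEF : E ⊆ F) {l₀ : Euc d →ₗ[ℝ] ℝ} {c₀ : ℝ} (hle : ∀ p ∈ R, l₀ p ≤ c₀)
    (heq : E = {p ∈ R | l₀ p = c₀}) {a : ℝ}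
    (ha : IsBeyond R F z ∧ l₀ z - c₀ ≤ a ∨ IsBeneath R F z ∧ a ≤ l₀ z - c₀) :
    ∃ (l : Euc d →ₗ[ℝ] ℝ) (c : ℝ),
      (∀ p ∈ R, l p ≤ c) ∧ E = {p ∈ R | l p = c} ∧ l z - c = a := by
  obtain ⟨l, c, hl⟩ := hR.exists_supports hF
  rw [isBeyond_iff hl hF, isBeneath_iff hl hF] at ha
  obtain ⟨t, ht, htz⟩ : ∃ t ≥ 0, t * (l z - c) = a - (l₀ z - c₀) := by
    rcases ha with ⟨hz, ha⟩ | ⟨hz, ha⟩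
    · exact ⟨(a - (l₀ z - c₀)) / (l z - c), div_nonneg (by linarith) (by linarith),
        div_mul_cancel₀ _ (by linarith)⟩
    · exact ⟨(a - (l₀ z - c₀)) / (l z - c), div_nonneg_of_nonpos (by linarith) (by linarith),
        div_mul_cancel₀ _ (by linarith)⟩
  obtain ⟨hle', heq'⟩ := setOf_add_smul_eq hle hl.2
    (fun p hp h => ((hl.mem_iff hF).1 (hEF (heq ▸ ⟨hp, h⟩))).2) ht
  refine ⟨l₀ + t • l, c₀ + t * c, hle', heq.trans heq'.symm, ?_⟩
  simp only [LinearMap.add_apply, LinearMap.smul_apply, smul_eq_mul]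
  linarith

theorem IsFullPolytope.isFace_sewn_of_isBeneath (hR : IsFullPolytope R) (hE : IsFace R E)
    (hF : F ∈ facets R) (hEF : E ⊆ F) (hz : IsBeneath R F z) : IsFace (sewn R z) E := by
  obtain ⟨l₀, c₀, hle₀, heq₀⟩ := hE.exists_functional_of_empty_or_nonempty
  obtain ⟨l, c, hle, heq, hlz⟩ := hR.exists_functional_add (a := min (l₀ z - c₀) (-1)) hF hEF hle₀
    heq₀ (Or.inr ⟨hz, min_le_left _ _⟩)
  have hlt : l z < c := by linarith [min_le_right (l₀ z - c₀) (-1)]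
  have hK := isFace_setOf l c (le_on_sewn hle hlt.le)
  convert hK
  rw [heq, ← setOf_sewn_inter (z := z), inter_eq_left]
  exact hK.subset_of_sewn hR.convex fun h => hlt.ne h.2

/-- The part of the boundary of `R` seen from `z` along its edge: `A` lies both in a facet beyond
which `z` lies and in a facet beneath which it lies. -/
def InHorizon (R : Set (Euc d)) (z : Euc d) (A : Set (Euc d)) : Prop :=
  (∃ F ∈ facets R, A ⊆ F ∧ IsBeyond R F z) ∧ ∃ F ∈ facets R, A ⊆ F ∧ IsBeneath R F z

theorem InHorizon.mono {A B : Set (Euc d)} (h : InHorizon R z B) (hAB : A ⊆ B) :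
    InHorizon R z A := by
  obtain ⟨⟨F, hF, hBF, hz⟩, F', hF', hBF', hz'⟩ := h
  exact ⟨⟨F, hF, hAB.trans hBF, hz⟩, F', hF', hAB.trans hBF', hz'⟩

theorem InHorizon.exists_functional_eq (hR : IsFullPolytope R) (hE : IsFace R E)
    (h : InHorizon R z E) : ∃ (l : Euc d →ₗ[ℝ] ℝ) (c : ℝ),
      (∀ p ∈ R, l p ≤ c) ∧ E = {p ∈ R | l p = c} ∧ l z = c := by
  obtain ⟨⟨F, hF, hEF, hz⟩, F', hF', hEF', hz'⟩ := h
  obtain ⟨l₀, c₀, hle₀, heq₀⟩ := hE.exists_functional_of_empty_or_nonempty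
  obtain ⟨l, c, hle, heq, hlz⟩ : ∃ (l : Euc d →ₗ[ℝ] ℝ) (c : ℝ),
      (∀ p ∈ R, l p ≤ c) ∧ E = {p ∈ R | l p = c} ∧ l z - c = 0 := by
    rcases le_total (l₀ z - c₀) 0 with h | h
    · exact hR.exists_functional_add hF hEF hle₀ heq₀ (Or.inl ⟨hz, h⟩)
    · exact hR.exists_functional_add hF' hEF' hle₀ heq₀ (Or.inr ⟨hz', h⟩)
  exact ⟨l, c, hle, heq, sub_eq_zero.1 hlz⟩

theorem InHorizon.isFace_convexHull_insert (hR : IsFullPolytope R) (hE : IsFace R E)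
    (h : InHorizon R z E) :
    IsFace (sewn R z) (convexHull ℝ (insert z E)) ∧ convexHull ℝ (insert z E) ∩ R = E := by
  obtain ⟨l, c, hle, heq, hlz⟩ := h.exists_functional_eq hR hE
  have hK := isFace_setOf l c (le_on_sewn hle hlz.le)
  set K := {p ∈ sewn R z | l p = c} with hK_def
  have hKR : K ∩ R = E := by rw [hK_def, setOf_sewn_inter, heq]
  have hzK : z ∈ K := ⟨mem_sewn, hlz⟩
  have hKeq : K = convexHull ℝ (insert z E) := by
    refine Subset.antisymm ?_ (convexHull_min (insert_subset hzK (hKR ▸ inter_subset_left))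
      (hK.convex (isFullPolytope_sewn hR z).convex))
    rw [hK.subset_iff_of_sewn (convex_convexHull ℝ _), hKR]
    exact ⟨fun _ => subset_convexHull ℝ _ (mem_insert _ _),
      (subset_insert _ _).trans (subset_convexHull ℝ _)⟩
  exact hKeq ▸ ⟨hK, hKR⟩

theorem IsFullPolytope.exists_isBeneath (hR : IsFullPolytope R) (hz : z ∉ R) :
    ∃ F ∈ facets R, IsBeneath R F z := by
  obtain ⟨f, t, hft, htz⟩ := geometric_hahn_banach_closed_point hR.convex hR.isCompact.isClosed hz
  obtain ⟨r, hr, hmin⟩ := hR.isCompact.exists_isMinOn hR.nonempty f.continuous.continuousOn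
  obtain ⟨l, c, hl⟩ := hR.exists_facetFunctionals
  have hfr := hft r hr
  obtain ⟨F, hF, hrF, hlt⟩ := hR.exists_facet_pos hl (convex_singleton r)
    (singleton_subset_iff.2 hr) (singleton_nonempty r) (l₀ := -(f : Euc d →ₗ[ℝ] ℝ)) (c₀ := -f r)
    (u := r - z) (fun p hp => neg_le_neg (hmin hp)) (fun p hp => by rw [hp]; rfl)
    (by simp; linarith)
  refine ⟨F, hF, (isBeneath_iff (hl F hF) hF).2 ?_⟩
  have := (((hl F hF).mem_iff hF).1 (hrF rfl)).2
  rw [map_sub] at hlt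
  linarith

theorem IsFullPolytope.exists_isBeneath_of_notMem (hR : IsFullPolytope R) (hz : z ∉ R)
    (hH : IsFace (sewn R z) H) (hzH : z ∉ H) : ∃ F ∈ facets R, H ⊆ F ∧ IsBeneath R F z := by
  rcases H.eq_empty_or_nonempty with rfl | hne
  · obtain ⟨F, hF, h⟩ := hR.exists_isBeneath hz
    exact ⟨F, hF, empty_subset F, h⟩
  obtain ⟨l, c, hl⟩ := hR.exists_facetFunctionals
  obtain ⟨l₀, c₀, hle, heq⟩ := hH.exists_functional hne
  have hHR := hH.subset_of_sewn hR.convex hzH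
  have hlH : ∀ p ∈ H, l₀ p = c₀ := fun p hp => by
    rw [heq] at hp
    exact hp.2
  have hlt : l₀ z < c₀ := (hle z mem_sewn).lt_of_ne fun h => hzH (heq ▸ ⟨mem_sewn, h⟩)
  obtain ⟨e, he⟩ := hne
  obtain ⟨F, hF, hHF, hpos⟩ := hR.exists_facet_pos hl (u := e - z)
    (hH.convex (isFullPolytope_sewn hR z).convex) hHR ⟨e, he⟩ (fun p hp => hle p (subset_sewn hp))
    hlH (by rw [map_sub, hlH e he]; linarith)
  refine ⟨F, hF, hHF, (isBeneath_iff (hl F hF) hF).2 ?_⟩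
  have := (((hl F hF).mem_iff hF).1 (hHF he)).2
  rw [map_sub] at hpos
  linarith

theorem IsFullPolytope.exists_facet_nonneg (hR : IsFullPolytope R)
    {l : Set (Euc d) → Euc d →ₗ[ℝ] ℝ} {c : Set (Euc d) → ℝ} (hl : FacetFunctionals R l c)
    (hH : IsFace (sewn R z) H) (hzH : z ∈ H) (hHR : H ≠ sewn R z) (hne : (H ∩ R).Nonempty)
    (σ : ℝ) : ∃ F ∈ facets R, H ∩ R ⊆ F ∧ 0 ≤ σ * (l F z - c F) := by
  by_contra! hcon
  obtain ⟨l₀, c₀, hle, heq⟩ := hH.exists_functional ⟨z, hzH⟩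
  have hHc := hH.convex (isFullPolytope_sewn hR z).convex
  have hlH : ∀ p ∈ H, l₀ p = c₀ := fun p hp => by
    rw [heq] at hp
    exact hp.2
  obtain ⟨r, -, hlr⟩ : ∃ r ∈ R, l₀ r < c₀ := by
    by_contra! h
    refine hHR (hH.subset.antisymm (convexHull_min (insert_subset hzH fun p hp => ?_) hHc))
    rw [heq]
    exact ⟨subset_sewn hp, le_antisymm (hle p (subset_sewn hp)) (h p hp)⟩
  obtain ⟨e, he⟩ := hne
  obtain ⟨t, ht, hall⟩ : ∃ t > 0, ∀ F ∈ facets R,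
      H ∩ R ⊆ F → σ * (l F z - c F) + t * (c F - l F r) ≤ 0 := by
    apply exists_pos_of_eventually
    rw [eventually_all_finite hR.finite_facets]
    intro F hF
    by_cases hHF : H ∩ R ⊆ F
    · have hneg := hcon F hF hHF
      filter_upwards [eventually_add_mul_nonpos hneg.le fun h => absurd h hneg.ne] with t ht _
        using ht
    · exact Eventually.of_forall fun t h => absurd h hHF
  obtain ⟨F, hF, hHF, hpos⟩ := hR.exists_facet_pos hl (u := σ • (z - e) + t • (e - r))
    (hHc.inter hR.convex) inter_subset_right ⟨e, he⟩ (fun p hp => hle p (subset_sewn hp))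
    (fun p hp => hlH p hp.1) (by
      simpa [hlH z hzH, hlH e he.1] using mul_pos ht (sub_pos.2 hlr))
  have hle' := hall F hF hHF
  rw [← (((hl F hF).mem_iff hF).1 (hHF he)).2] at hle'
  simp only [map_add, map_smul, map_sub, smul_eq_mul] at hpos
  linarith

theorem IsFullPolytope.inHorizon_inter (hR : IsFullPolytope R) (hz : z ∉ R)
    (hgen : ∀ F ∈ facets R, IsBeyond R F z ∨ IsBeneath R F z) (hH : IsFace (sewn R z) H)
    (hzH : z ∈ H) (hHR : H ≠ sewn R z) : InHorizon R z (H ∩ R) := by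
  rcases (H ∩ R).eq_empty_or_nonempty with hempty | hne
  · rw [hempty]
    obtain ⟨F, hF, h⟩ := hR.exists_isBeyond hz
    obtain ⟨F', hF', h'⟩ := hR.exists_isBeneath hz
    exact ⟨⟨F, hF, empty_subset F, h⟩, F', hF', empty_subset F', h'⟩
  obtain ⟨l, c, hl⟩ := hR.exists_facetFunctionals
  constructor
  · obtain ⟨F, hF, hsub, h⟩ := hR.exists_facet_nonneg hl hH hzH hHR hne 1
    refine ⟨F, hF, hsub, (hgen F hF).resolve_right fun h' => ?_⟩
    rw [isBeneath_iff (hl F hF) hF] at h'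
    linarith
  · obtain ⟨F, hF, hsub, h⟩ := hR.exists_facet_nonneg hl hH hzH hHR hne (-1)
    refine ⟨F, hF, hsub, (hgen F hF).resolve_left fun h' => ?_⟩
    rw [isBeyond_iff (hl F hF) hF] at h'
    linarith

end Sewn

section Simplicial

variable {d : ℕ} {P R F A D : Set (Euc d)}

theorem exists_affineMap_eqOn (hD : AffineIndependent ℝ (Subtype.val : D → Euc d))
    (w : Euc d → ℝ) : ∃ f : Euc d →ᵃ[ℝ] ℝ, EqOn f w D := by
  classical
  obtain ⟨T, hDT, hT, hspan⟩ := exists_subset_affineIndependent_affineSpan_eq_top hD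
  let b : AffineBasis T ℝ (Euc d) := ⟨Subtype.val, hT, by simpa using hspan⟩
  have : Fintype T := @Fintype.ofFinite T b.finite
  refine ⟨(Fintype.linearCombination ℝ fun p : T => w p).toAffineMap.comp b.coords, fun q hq => ?_⟩
  have hb (p : T) : b.coord p q = if p = ⟨q, hDT hq⟩ then 1 else 0 :=
    b.coord_apply p ⟨q, hDT hq⟩
  simp [Fintype.linearCombination_apply, hb]

theorem isFace_convexHull_of_affineIndependent
    (hD : AffineIndependent ℝ (Subtype.val : D → Euc d)) (hA : A ⊆ D) :
    IsFace (convexHull ℝ D) (convexHull ℝ A) := by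
  classical
  obtain ⟨f, hf⟩ := exists_affineMap_eqOn hD fun p => if p ∈ A then 0 else -1
  have hf' : ∀ p ∈ D, f.linear p + f 0 = if p ∈ A then 0 else -1 := fun p hp => by
    have h := hf hp
    rwa [f.decomp] at h
  have hle : ∀ p ∈ convexHull ℝ D, f.linear p ≤ -f 0 := by
    refine fun p hp => convexHull_min (fun q hq => ?_) (convex_halfSpace_le f.linear.isLinear _) hp
    have := hf' q hq
    rw [mem_ofPred_eq]
    split_ifs at this <;> linarith
  have hface := isFace_setOf f.linear (-f 0) hle
  suffices h : {p ∈ convexHull ℝ D | f.linear p = -f 0} ∩ D = A by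
    rwa [hface.eq_convexHull_inter, h] at hface
  have key : ∀ p ∈ D, (f.linear p = -f 0 ↔ p ∈ A) := fun p hp => by
    have := hf' p hp
    rw [← add_eq_zero_iff_eq_neg, this]
    simp
  ext p
  exact ⟨fun hp => (key p hp.2).1 hp.1.2,
    fun hp => ⟨⟨subset_convexHull ℝ _ (hA hp), (key p (hA hp)).2 hp⟩, hA hp⟩⟩

/-- All proper faces are simplices. -/
def IsSimplicial (P : Set (Euc d)) : Prop :=
  ∀ F, IsFace P F → F ≠ P → AffineIndependent ℝ (Subtype.val : vertices F → Euc d)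

theorem IsSimplicial.isFace_convexHull (hS : IsSimplicial P) (hP : IsFullPolytope P)
    (hF : IsFace P F) (hFP : F ≠ P) (hAF : A ⊆ F) (hA : A ⊆ vertices P) :
    IsFace P (convexHull ℝ A) := by
  have hvert : vertices F = F ∩ vertices P := by rw [hP.vertices_face hF, inter_comm]
  have hAF' := isFace_convexHull_of_affineIndependent (hS F hF hFP)
    (hvert ▸ subset_inter hAF hA)
  rw [hvert, hP.convexHull_inter_vertices hF] at hAF'
  exact hP.isFace_of_isExtreme (convex_convexHull ℝ A) (hF.isExtreme.trans hAF'.isExtreme)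

theorem IsFullPolytope.convexHull_inter_vertices_eq (hR : IsFullPolytope R)
    (hA : A ⊆ vertices R) : convexHull ℝ A ∩ vertices R = A :=
  Subset.antisymm
    (fun _ hv => hR.mem_of_mem_convexHull (hA.trans vertices_subset) hv.2 hv.1)
    (subset_inter (subset_convexHull ℝ A) hA)

theorem IsFullPolytope.lt_ncard_vertices (hR : IsFullPolytope R) :
    d < (vertices R).ncard := by
  have : Fintype (vertices R) := hR.finite_vertices.fintype
  have : Nonempty (vertices R) := by
    rw [nonempty_coe_sort, ← convexHull_nonempty_iff (𝕜 := ℝ), hR.convexHull_vertices]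
    exact hR.nonempty
  have h := finrank_vectorSpan_range_add_one_le ℝ (Subtype.val : vertices R → Euc d)
  rw [Subtype.range_coe, ← direction_affineSpan, ← affineSpan_convexHull, hR.convexHull_vertices,
    hR.2, AffineSubspace.direction_top, finrank_top, finrank_euclideanSpace_fin] at h
  rwa [← Nat.card_coe_set_eq, Nat.card_eq_fintype_card]

theorem exists_mem_forall_mem_of_mem_convexHull (hR : Convex ℝ R) (hA : A ⊆ R) {q : Euc d}
    (hq : q ∈ convexHull ℝ A) : ∃ b ∈ A, ∀ F, IsFace R F → q ∈ F → b ∈ F := by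
  have hconv : Convex ℝ {p ∈ R | ∃ b ∈ A, ∀ F, IsFace R F → p ∈ F → b ∈ F} := by
    rw [convex_iff_openSegment_subset]
    rintro p ⟨hp, b, hb, hbF⟩ p' ⟨hp', -⟩ r hr
    exact ⟨hR.openSegment_subset hp hp' hr, b, hb, fun F hF hrF =>
      hbF F hF (hF.isExtreme.left_mem_of_mem_openSegment hp hp' hrF hr)⟩
  exact (convexHull_min (fun p hp => show p ∈ R ∧ _ from ⟨hA hp, p, hp, fun _ _ h => h⟩)
    hconv hq).2

theorem IsNeighbourly.disjoint_convexHull (hN : IsNeighbourly P) (hP : IsFullPolytope P)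
    {X Y : Set (Euc d)} (hX : X ⊆ vertices P) (hY : Y ⊆ vertices P) (hXY : Disjoint X Y)
    (hcard : X.ncard ≤ d / 2) : Disjoint (convexHull ℝ X) (convexHull ℝ Y) := by
  rw [Set.disjoint_left]
  intro q hqX hqY
  obtain ⟨b, hb, hbF⟩ :=
    exists_mem_forall_mem_of_mem_convexHull hP.convex (hY.trans vertices_subset) hqY
  have hXb : X ⊆ vertices P \ {b} :=
    subset_sdiff_singleton hX fun h => Set.disjoint_left.1 hXY h hb
  have hdiff : d / 2 ≤ (vertices P \ {b}).ncard := by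
    have := ncard_sdiff_singleton_add_one (hY hb) hP.finite_vertices
    have := hP.lt_ncard_vertices
    omega
  obtain ⟨A, hXA, hA, hAcard⟩ := exists_subsuperset_card_eq hXb hcard hdiff
  have hfin : A.Finite := hP.finite_vertices.subset (hA.trans sdiff_subset)
  have hface := (hN hfin.toFinset (by simpa using hA.trans sdiff_subset)
    (by rw [← hAcard, ncard_eq_toFinset_card A hfin])).1
  rw [hfin.coe_toFinset] at hface
  have hbA := hP.mem_of_mem_convexHull (hA.trans (sdiff_subset.trans vertices_subset)) (hY hb)
    (hbF _ hface (convexHull_mono hXA hqX))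
  exact (hA hbA).2 rfl

theorem IsNeighbourly.affineIndependent (hN : IsNeighbourly P) (hP : IsFullPolytope P)
    (hA : A ⊆ vertices P) (hcard : A.ncard ≤ 2 * (d / 2) + 1) :
    AffineIndependent ℝ (Subtype.val : A → Euc d) := by
  by_contra hdep
  have : Finite A := hP.finite_vertices.subset hA
  obtain ⟨I, q, hq, hq'⟩ := Convex.radon_partition hdep
  have hsub (J : Set A) : Subtype.val '' J ⊆ vertices P := (Subtype.coe_image_subset A J).trans hA
  have hdisj : Disjoint (Subtype.val '' I) (Subtype.val '' Iᶜ) :=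
    (disjoint_image_iff Subtype.val_injective).2 disjoint_compl_right
  have hsum := ncard_add_ncard_compl I
  rw [Nat.card_coe_set_eq, ← ncard_image_of_injective I Subtype.val_injective,
    ← ncard_image_of_injective Iᶜ Subtype.val_injective] at hsum
  rcases le_or_gt (Subtype.val '' I).ncard (d / 2) with h | h
  · exact Set.disjoint_left.1 (hN.disjoint_convexHull hP (hsub I) (hsub Iᶜ) hdisj h) hq hq'
  · exact Set.disjoint_left.1 (hN.disjoint_convexHull hP (hsub Iᶜ) (hsub I) hdisj.symm (by omega))
      hq' hq

theorem dim_add_one_le_of_isFace (hP : IsFullPolytope P) (hF : IsFace P F) (hFP : F ≠ P)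
    (hne : F.Nonempty) : dim F + 1 ≤ d := by
  obtain ⟨G, hG, hFG⟩ := hP.exists_facet_supset hF hne hFP
  have := Submodule.finrank_mono (vectorSpan_mono ℝ hFG)
  have := hG.2.2
  rw [hP.dim_eq] at this
  simp only [dim] at *
  omega

theorem IsNeighbourly.isSimplicial (hN : IsNeighbourly P) (hP : IsFullPolytope P) (hd : Even d) :
    IsSimplicial P := by
  intro F hF hFP
  have hFV : vertices F ⊆ vertices P := by
    rw [hP.vertices_face hF]
    exact inter_subset_left
  refine hN.affineIndependent hP hFV ?_
  rw [Nat.two_mul_div_two_of_even hd]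
  by_contra! hbig
  obtain ⟨T, hTF, hT⟩ := exists_subset_card_eq hbig.le
  have hT0 : T.Nonempty := nonempty_of_ncard_ne_zero (by omega)
  have : Fintype T := (finite_of_ncard_pos (by omega : 0 < T.ncard)).fintype
  have hind := hN.affineIndependent hP (hTF.trans hFV)
    (by rw [hT, Nat.two_mul_div_two_of_even hd])
  have hrank := hind.finrank_vectorSpan (n := d)
    (by rw [← Nat.card_eq_fintype_card, Nat.card_coe_set_eq, hT])
  rw [Subtype.range_coe] at hrank
  have hTF' := hTF.trans vertices_subset
  have hle := Submodule.finrank_mono (vectorSpan_mono ℝ hTF')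
  have hdim := dim_add_one_le_of_isFace hP hF hFP (hT0.mono hTF')
  unfold dim at hdim
  omega

end Simplicial

section Level

variable {d m j : ℕ} {R F : Set (Euc d)} {Φ : ℕ → Set (Euc d)} {z : Euc d}

/-- The level of `F` with respect to the chain `Φ_1 ⊆ … ⊆ Φ_m`: the largest `j` with `Φ_j ⊆ F`,
or `0` if there is none. A point exactly beyond the chain is beyond the facets of odd level and
beneath those of even level. -/
noncomputable def level (m : ℕ) (Φ : ℕ → Set (Euc d)) (F : Set (Euc d)) : ℕ :=
  sSup {j ∈ Iic m | Φ j ⊆ F}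

theorem level_le : level m Φ F ≤ m := csSup_le' fun _ hj => hj.1

theorem le_level_iff (hΦ : MonotoneOn Φ (Iic m)) (hj : 1 ≤ j) (hjm : j ≤ m) :
    j ≤ level m Φ F ↔ Φ j ⊆ F := by
  have hbdd : BddAbove {j ∈ Iic m | Φ j ⊆ F} := ⟨m, fun _ hj => hj.1⟩
  refine ⟨fun h => ?_, fun h => le_csSup hbdd ⟨hjm, h⟩⟩
  have hne : {j ∈ Iic m | Φ j ⊆ F}.Nonempty := by
    rw [nonempty_iff_ne_empty]
    intro hempty
    rw [level, hempty, csSup_empty, bot_eq_zero] at h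
    omega
  have hmem : level m Φ F ∈ {j ∈ Iic m | Φ j ⊆ F} := Nat.sSup_mem hne hbdd
  exact (hΦ hjm hmem.1 h).trans hmem.2

theorem mem_beyondFacets_iff (hΦ : MonotoneOn Φ (Iic m)) (hF : F ∈ facets R) :
    F ∈ beyondFacets R m Φ ↔ Odd (level m Φ F) := by
  have hmem {j : ℕ} (hj : 1 ≤ j) : F ∈ towerFacets R m Φ j ↔ j ≤ level m Φ F := by
    simp only [towerFacets, mem_ofPred_eq, hF, true_and, hj, true_imp_iff]
    refine ⟨fun h => (le_level_iff hΦ hj h.1).2 h.2, fun h => ?_⟩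
    have hjm := h.trans level_le
    exact ⟨hjm, (le_level_iff hΦ hj hjm).1 h⟩
  simp only [beyondFacets, mem_iUnion, Set.mem_sdiff]
  constructor
  · rintro ⟨k, h₁, h₂⟩
    rw [hmem (by omega)] at h₁ h₂
    exact ⟨k, by omega⟩
  · rintro ⟨k, hk⟩
    exact ⟨k, (hmem (by omega)).2 hk.ge, fun h => by
      rw [hmem (by omega)] at h
      omega⟩

theorem IsExactlyBeyond.isBeyond_iff (hz : IsExactlyBeyond R m Φ z) (hΦ : MonotoneOn Φ (Iic m))
    (hF : F ∈ facets R) : IsBeyond R F z ↔ Odd (level m Φ F) := by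
  rw [← mem_beyondFacets_iff hΦ hF]
  refine ⟨fun h => ?_, hz.1 F⟩
  by_contra hF'
  exact h.not_isBeneath hF (hz.2 F ⟨hF, hF'⟩)

theorem IsExactlyBeyond.isBeneath_iff (hz : IsExactlyBeyond R m Φ z) (hΦ : MonotoneOn Φ (Iic m))
    (hF : F ∈ facets R) : IsBeneath R F z ↔ Even (level m Φ F) := by
  rw [← Nat.not_odd_iff_even, ← mem_beyondFacets_iff hΦ hF]
  exact ⟨fun h hF' => (hz.1 F hF').not_isBeneath hF h, fun h => hz.2 F ⟨hF, h⟩⟩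

theorem IsExactlyBeyond.inHorizon_iff {A : Set (Euc d)} (hz : IsExactlyBeyond R m Φ z)
    (hΦ : MonotoneOn Φ (Iic m)) : InHorizon R z A ↔
      (∃ F ∈ facets R, A ⊆ F ∧ Odd (level m Φ F)) ∧
        ∃ F ∈ facets R, A ⊆ F ∧ Even (level m Φ F) := by
  rw [InHorizon]
  refine and_congr ?_ ?_ <;> refine exists_congr fun F => and_congr_right fun hF => ?_
  · rw [hz.isBeyond_iff hΦ hF]
  · rw [hz.isBeneath_iff hΦ hF]

theorem IsExactlyBeyond.isBeyond_or_isBeneath (hz : IsExactlyBeyond R m Φ z)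
    (hF : F ∈ facets R) : IsBeyond R F z ∨ IsBeneath R F z :=
  (em (F ∈ beyondFacets R m Φ)).imp (hz.1 F) fun h => hz.2 F ⟨hF, h⟩

end Level

section Tower

variable {d m i j k : ℕ} {P E : Set (Euc d)} {x y : ℕ → Euc d}

theorem convex_towerFace : Convex ℝ (towerFace x y j) := by
  cases j with
  | zero => exact convex_empty
  | succ j => exact convex_convexHull ℝ _

theorem monotone_towerFace : Monotone (towerFace x y) :=
  monotone_nat_of_le_succ fun _ => subset_union_left.trans (subset_convexHull ℝ _)

/-- The points `x_1, …, x_j, y_1, …, y_j` that span `Φ_j`. -/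
def towerVertices (x y : ℕ → Euc d) (j : ℕ) : Set (Euc d) := x '' Icc 1 j ∪ y '' Icc 1 j

/-- The points `x_1, …, x_j, y_1, …, y_{j-1}` that span, for `1 ≤ j`, the facet `[Φ_{j-1}, x_j]`
of `Φ_j`. -/
def baseVertices (x y : ℕ → Euc d) (j : ℕ) : Set (Euc d) := insert (x j) (towerVertices x y (j - 1))

theorem insert_baseVertices (hj : 1 ≤ j) :
    insert (y j) (baseVertices x y j) = towerVertices x y j := by
  obtain ⟨j, rfl⟩ := Nat.exists_eq_add_of_le' hj
  have hIcc : Icc 1 (j + 1) = insert (j + 1) (Icc 1 j) := by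
    ext k
    simp only [mem_Icc, mem_insert_iff]
    omega
  rw [baseVertices, towerVertices, towerVertices, hIcc, image_insert_eq, image_insert_eq,
    insert_union, union_insert, insert_comm, Nat.add_sub_cancel]

theorem towerFace_eq_convexHull (j : ℕ) :
    towerFace x y j = convexHull ℝ (towerVertices x y j) := by
  induction j with
  | zero => simp [towerFace, towerVertices]
  | succ j ih =>
    rw [towerFace, ih, convexHull_convexHull_union_left,
      ← insert_baseVertices (j := j + 1) (by omega), baseVertices, Nat.add_sub_cancel,
      insert_comm, union_insert, union_singleton]

theorem towerFace_subset_convexHull {A : Set (Euc d)} (hA : towerVertices x y j ⊆ A) :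
    towerFace x y j ⊆ convexHull ℝ A :=
  (towerFace_eq_convexHull j).le.trans (convexHull_mono hA)

theorem convexHull_insert_towerFace (v : Euc d) (j : ℕ) :
    convexHull ℝ (insert v (towerFace x y j)) = convexHull ℝ (insert v (towerVertices x y j)) := by
  rw [towerFace_eq_convexHull, insert_eq, convexHull_convexHull_union_right, ← insert_eq]

theorem convexHull_union_pair_eq (x y : ℕ → Euc d) (i : ℕ) (z : Euc d) :
    convexHull ℝ (towerFace x y (i - 1) ∪ {x i, z}) =
      convexHull ℝ (insert z (convexHull ℝ (baseVertices x y i))) := by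
  rw [towerFace_eq_convexHull, convexHull_convexHull_union_left, insert_eq z (convexHull ℝ _),
    convexHull_convexHull_union_right, ← insert_eq, baseVertices, insert_comm, union_insert,
    union_singleton]

theorem le_level_towerFace_iff {F : Set (Euc d)} (hF : Convex ℝ F) (hj : j ≤ m) :
    j ≤ level m (towerFace x y) F ↔ towerVertices x y j ⊆ F := by
  rcases Nat.eq_zero_or_pos j with rfl | hpos
  · simp [towerVertices]
  · rw [le_level_iff (monotone_towerFace.monotoneOn _) hpos hj, towerFace_eq_convexHull,
      hF.convexHull_subset_iff]

namespace IsUniversalTower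

theorem isFace (hT : IsUniversalTower P m x y) (hj : j ≤ m) : IsFace P (towerFace x y j) := by
  rcases Nat.eq_zero_or_pos j with rfl | hpos
  · exact isExposed_empty
  · exact (hT.universal j ⟨hpos, hj⟩).1

theorem ne_polytope (hT : IsUniversalTower P m x y) (hP : IsFullPolytope P) (hmd : 2 * m ≤ d)
    (hj : j ≤ m) : towerFace x y j ≠ P := by
  rcases Nat.eq_zero_or_pos j with rfl | hpos
  · exact hP.nonempty.ne_empty.symm
  · intro h
    have hdim := (hT.universal j ⟨hpos, hj⟩).2.2.1
    rw [h, hP.dim_eq] at hdim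
    omega

theorem isFace_convexHull_insert (hT : IsUniversalTower P m x y) (hmd : 2 * m ≤ d) (hi : 1 ≤ i)
    (him : i < m) {v : Euc d} (hv : v ∈ vertices P) :
    IsFace P (convexHull ℝ (insert v (towerFace x y i))) := by
  simpa [← insert_eq] using (hT.universal i ⟨hi, him.le⟩).2.2.2 {v} (by simpa using hv)
    (by rw [Finset.card_singleton]; omega)

theorem towerVertices_subset (hT : IsUniversalTower P m x y) (hj : j ≤ m) :
    towerVertices x y j ⊆ vertices P :=
  union_subset (image_subset_iff.2 fun k hk => hT.x_mem k ⟨hk.1, hk.2.trans hj⟩)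
    (image_subset_iff.2 fun k hk => hT.y_mem k ⟨hk.1, hk.2.trans hj⟩)

theorem mem_towerFace_iff (hT : IsUniversalTower P m x y) (hP : IsFullPolytope P) (hj : j ≤ m)
    {v : Euc d} (hv : v ∈ vertices P) : v ∈ towerFace x y j ↔ v ∈ towerVertices x y j := by
  rw [towerFace_eq_convexHull, ← and_iff_left (a := v ∈ convexHull ℝ _) hv, ← mem_inter_iff,
    hP.convexHull_inter_vertices_eq (hT.towerVertices_subset hj)]

theorem vertices_towerFace (hT : IsUniversalTower P m x y) (hP : IsFullPolytope P) (hj : j ≤ m) :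
    vertices (towerFace x y j) = towerVertices x y j := by
  rw [hP.vertices_face (hT.isFace hj), towerFace_eq_convexHull, inter_comm,
    hP.convexHull_inter_vertices_eq (hT.towerVertices_subset hj)]

theorem x_notMem (hT : IsUniversalTower P m x y) (hjk : j < k) (hk : k ≤ m) :
    x k ∉ towerVertices x y j := by
  have hkm : k ∈ Icc 1 m := ⟨by omega, hk⟩
  rintro (⟨l, hl, h⟩ | ⟨l, hl, h⟩)
  · exact (hl.2.trans_lt hjk).ne (hT.x_inj ⟨hl.1, by have := hl.2; omega⟩ hkm h)
  · exact hT.x_ne_y k hkm l ⟨hl.1, by have := hl.2; omega⟩ h.symm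

theorem y_notMem (hT : IsUniversalTower P m x y) (hjk : j < k) (hk : k ≤ m) :
    y k ∉ towerVertices x y j := by
  have hkm : k ∈ Icc 1 m := ⟨by omega, hk⟩
  rintro (⟨l, hl, h⟩ | ⟨l, hl, h⟩)
  · exact hT.x_ne_y l ⟨hl.1, by have := hl.2; omega⟩ k hkm h
  · exact (hl.2.trans_lt hjk).ne (hT.y_inj ⟨hl.1, by have := hl.2; omega⟩ hkm h)

theorem y_notMem_baseVertices (hT : IsUniversalTower P m x y) (hi : 1 ≤ i) (him : i ≤ m) :
    y i ∉ baseVertices x y i := by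
  rintro (h | h)
  · exact hT.x_ne_y i ⟨hi, him⟩ i ⟨hi, him⟩ h.symm
  · exact hT.y_notMem (by omega) him h

theorem exists_facet_level_eq (hT : IsUniversalTower P m x y) (hP : IsFullPolytope P)
    (hE : IsFace P E) (hne : E.Nonempty) (hj : j < m) (hsub : towerVertices x y j ⊆ E)
    (hsub' : ¬ towerVertices x y (j + 1) ⊆ E) :
    ∃ F ∈ facets P, E ⊆ F ∧ level m (towerFace x y) F = j := by
  obtain ⟨w, hw, hwE⟩ := not_subset.1 hsub'
  obtain ⟨F, hF, hEF, hwF⟩ := hP.exists_facet_notMem hE hne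
    (vertices_subset (hT.towerVertices_subset hj hw)) hwE
  have hFc := hF.1.convex hP.convex
  refine ⟨F, hF, hEF, le_antisymm (not_lt.1 fun h => hwF ?_) ?_⟩
  · exact (le_level_towerFace_iff hFc hj).1 h hw
  · exact (le_level_towerFace_iff hFc hj.le).2 (hsub.trans hEF)

theorem exists_facet_level_self (hT : IsUniversalTower P m x y) (hP : IsFullPolytope P)
    (hmd : 2 * m ≤ d) (hj : 1 ≤ j) (hjm : j ≤ m) :
    ∃ F ∈ facets P, level m (towerFace x y) F = j := by
  have hface := hT.isFace hjm
  have hne := (hT.universal j ⟨hj, hjm⟩).2.1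
  have hsub : towerVertices x y j ⊆ towerFace x y j := by
    rw [towerFace_eq_convexHull]
    exact subset_convexHull ℝ _
  rcases hjm.eq_or_lt with rfl | hlt
  · obtain ⟨F, hF, hjF⟩ := hP.exists_facet_supset hface hne (hT.ne_polytope hP hmd le_rfl)
    exact ⟨F, hF, le_antisymm level_le
      ((le_level_towerFace_iff (hF.1.convex hP.convex) le_rfl).2 (hsub.trans hjF))⟩
  · obtain ⟨F, hF, -, hlevel⟩ := hT.exists_facet_level_eq hP hface hne hlt hsub fun h => by
      have hx : x (j + 1) ∈ towerVertices x y (j + 1) := Or.inl ⟨j + 1, by simp, rfl⟩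
      exact hT.x_notMem (Nat.lt_succ_self j) hlt
        ((hT.mem_towerFace_iff hP hjm (hT.towerVertices_subset hlt hx)).1 (h hx))
    exact ⟨F, hF, hlevel⟩

end IsUniversalTower

end Tower

theorem exists_orderIso_of_range_eq {α β γ : Type*} [PartialOrder α] [PartialOrder β]
    [PartialOrder γ] (f : α ↪o γ) (g : β ↪o γ) (h : range f = range g) :
    ∃ Θ : α ≃o β, ∀ a, g (Θ a) = f a := by
  let Θ : α ≃o β := f.orderIso.trans ((OrderIso.setCongr _ _ h).trans g.orderIso.symm)
  refine ⟨Θ, fun a => ?_⟩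
  have hΘ : g.orderIso (Θ a) = OrderIso.setCongr _ _ h (f.orderIso a) :=
    g.orderIso.apply_symm_apply _
  exact congrArg Subtype.val hΘ

section FaceLattice

variable {d e : ℕ} {R : Set (Euc d)} {R' : Set (Euc e)}

theorem nonempty_orderIso_apply (ψ : Face R ≃o Face R') {f : Face R} (hf : f.1.Nonempty) :
    (ψ f).1.Nonempty := by
  rw [nonempty_iff_ne_empty]
  intro h
  have hle : ψ f ≤ ψ ⟨∅, isExposed_empty⟩ := by
    rw [← Subtype.coe_le_coe, h]
    exact empty_subset _
  exact hf.ne_empty (subset_empty_iff.1 (ψ.le_iff_le.1 hle))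

theorem IsFullPolytope.exists_orderIso_apply_eq_singleton (hR' : IsFullPolytope R')
    (ψ : Face R ≃o Face R') {v : Euc d} (hv : v ∈ vertices R) :
    ∃ q, (ψ ⟨{v}, hv⟩).1 = {q} := by
  obtain ⟨q, hq, hqf⟩ := hR'.exists_vertex_mem (ψ ⟨{v}, hv⟩).2
    (nonempty_orderIso_apply ψ (singleton_nonempty v))
  have hle : ψ.symm ⟨{q}, hq⟩ ≤ ⟨{v}, hv⟩ :=
    (ψ.symm_apply_le).2 (singleton_subset_iff.2 hqf)
  have heq : ψ.symm ⟨{q}, hq⟩ = ⟨{v}, hv⟩ := Subtype.ext <|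
    (nonempty_orderIso_apply ψ.symm (singleton_nonempty q)).subset_singleton_iff.1 hle
  exact ⟨q, by rw [← heq, OrderIso.apply_symm_apply]⟩

theorem exists_isCombinatorialIso (hR : IsFullPolytope R) (hR' : IsFullPolytope R')
    (ψ : Face R ≃o Face R') : ∃ φ : Euc d → Euc e, IsCombinatorialIso R R' φ ∧
      ∀ v (hv : v ∈ vertices R), (ψ ⟨{v}, hv⟩).1 = {φ v} := by
  choose! φ hφ using fun v => hR'.exists_orderIso_apply_eq_singleton ψ (v := v)
  choose! χ hχ using fun q => hR.exists_orderIso_apply_eq_singleton ψ.symm (v := q)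
  have hφv : MapsTo φ (vertices R) (vertices R') := fun v hv => by
    rw [vertices, mem_ofPred_eq, ← hφ v hv]
    exact (ψ _).2
  have hχv : MapsTo χ (vertices R') (vertices R) := fun q hq => by
    rw [vertices, mem_ofPred_eq, ← hχ q hq]
    exact (ψ.symm _).2
  have hleft : LeftInvOn χ φ (vertices R) := fun v hv => by
    have hψ : ψ ⟨{v}, hv⟩ = ⟨{φ v}, hφv hv⟩ := Subtype.ext (hφ v hv)
    rw [← singleton_eq_singleton_iff, ← hχ _ (hφv hv), ← hψ, OrderIso.symm_apply_apply]
  have hright : RightInvOn χ φ (vertices R') := fun q hq => by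
    have hψ : ψ.symm ⟨{q}, hq⟩ = ⟨{χ q}, hχv hq⟩ := Subtype.ext (hχ q hq)
    rw [← singleton_eq_singleton_iff, ← hφ _ (hχv hq), ← hψ, OrderIso.apply_symm_apply]
  refine ⟨φ, ⟨InvOn.bijOn ⟨hleft, hright⟩ hφv hχv, ψ, fun F => ?_⟩, hφ⟩
  have hmem : ∀ v ∈ vertices R, φ v ∈ (ψ F).1 ↔ v ∈ F.1 := fun v hv => by
    rw [← singleton_subset_iff, ← singleton_subset_iff (s := F.1), ← hφ v hv]
    exact ψ.le_iff_le (x := ⟨{v}, hv⟩) (y := F)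
  ext q
  constructor
  · rintro ⟨hqF, hq⟩
    rw [← hright hq] at hqF ⊢
    exact mem_image_of_mem φ ⟨(hmem _ (hχv hq)).1 hqF, hχv hq⟩
  · rintro ⟨v, ⟨hvF, hv⟩, rfl⟩
    exact ⟨(hmem v hv).2 hvF, hφv hv⟩

theorem mem_vertices_of_subsingleton [Subsingleton (Euc d)] (hR : R.Nonempty) (p : Euc d) :
    p ∈ vertices R := by
  have hRp : R = {p} := (Subsingleton.eq_univ_of_nonempty hR).trans
    (Subsingleton.eq_univ_of_nonempty (singleton_nonempty p)).symm
  exact hRp ▸ IsExposed.refl _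

theorem isCombinatorialIso_id_of_subsingleton [Subsingleton (Euc e)] {R : Set (Euc e)}
    (hR : R.Nonempty) (hR' : R'.Nonempty) : IsCombinatorialIso R R' id := by
  obtain rfl : R = R' := (Subsingleton.eq_univ_of_nonempty hR).trans
    (Subsingleton.eq_univ_of_nonempty hR').symm
  exact ⟨bijOn_id _, OrderIso.refl _, fun F => (image_id _).symm⟩

end FaceLattice

section Quotient

variable {d e : ℕ} {P : Set (Euc d)} {G : Face P}

namespace QuotientPolytope

variable (Q : QuotientPolytope P G e)

/-- The face of `P` that corresponds to a face of the quotient. -/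
def lift (f : Face Q.carrier) : Set (Euc d) := (Q.faceIso f).1.1

theorem isFace_lift (f : Face Q.carrier) : IsFace P (Q.lift f) := (Q.faceIso f).1.2

theorem subset_lift (f : Face Q.carrier) : G.1 ⊆ Q.lift f := (Q.faceIso f).2

theorem lift_subset_lift {f g : Face Q.carrier} : Q.lift f ⊆ Q.lift g ↔ f.1 ⊆ g.1 :=
  Q.faceIso.le_iff_le (x := f) (y := g)

theorem lift_injective : Function.Injective Q.lift := fun _ _ h =>
  Q.faceIso.injective (Subtype.ext (Subtype.ext h))

theorem exists_lift_eq {E : Set (Euc d)} (hE : IsFace P E) (hG : G.1 ⊆ E) :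
    ∃ f, Q.lift f = E :=
  ⟨Q.faceIso.symm ⟨⟨E, hE⟩, hG⟩, by rw [lift, OrderIso.apply_symm_apply]⟩

theorem lift_self : Q.lift ⟨Q.carrier, IsExposed.refl _⟩ = P := by
  obtain ⟨f, hf⟩ := Q.exists_lift_eq (IsExposed.refl P) G.2.subset
  exact (Q.isFace_lift _).subset.antisymm (hf.ge.trans (Q.lift_subset_lift.2 f.2.subset))

theorem lift_empty : Q.lift ⟨∅, isExposed_empty⟩ = G.1 := by
  obtain ⟨f, hf⟩ := Q.exists_lift_eq G.2 Subset.rfl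
  exact ((Q.lift_subset_lift.2 (empty_subset f.1)).trans hf.le).antisymm (Q.subset_lift _)

theorem star_lift (f : Face Q.carrier) : Q.star (Q.lift f) = f.1 := by
  ext q
  refine ⟨?_, fun hq => ⟨f, rfl, hq⟩⟩
  rintro ⟨g, hg, hq⟩
  rwa [Q.lift_injective hg] at hq

theorem lift_eq_self_iff {f : Face Q.carrier} : Q.lift f = P ↔ f.1 = Q.carrier :=
  ⟨fun h => congrArg Subtype.val (Q.lift_injective (h.trans Q.lift_self.symm)),
    fun h => (congrArg Q.lift (Subtype.ext h)).trans Q.lift_self⟩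

theorem lift_mem_facets_iff (hP : IsFullPolytope P) (hd : 0 < d) (he : 0 < e)
    {f : Face Q.carrier} : Q.lift f ∈ facets P ↔ f.1 ∈ facets Q.carrier := by
  rw [hP.mem_facets_iff hd, Q.isFullPolytope.mem_facets_iff he, Ne, Ne, Q.lift_eq_self_iff]
  constructor
  · rintro ⟨-, hne, hmax⟩
    refine ⟨f.2, hne, fun g hg hfg hgne => ?_⟩
    exact Q.lift_subset_lift.1 (hmax (Q.lift ⟨g, hg⟩) (Q.isFace_lift _)
      (Q.lift_subset_lift.2 hfg) fun h => hgne (Q.lift_eq_self_iff.1 h))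
  · rintro ⟨-, hne, hmax⟩
    refine ⟨Q.isFace_lift f, hne, fun E hE hfE hEne => ?_⟩
    obtain ⟨g, rfl⟩ := Q.exists_lift_eq hE ((Q.subset_lift f).trans hfE)
    exact Q.lift_subset_lift.2 (hmax g.1 g.2 (Q.lift_subset_lift.1 hfE)
      fun h => hEne (Q.lift_eq_self_iff.2 h))

theorem star_subset_iff {E : Set (Euc d)} (hE : IsFace P E) (hG : G.1 ⊆ E) {f : Face Q.carrier} :
    Q.star E ⊆ f.1 ↔ E ⊆ Q.lift f := by
  obtain ⟨g, rfl⟩ := Q.exists_lift_eq hE hG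
  rw [Q.star_lift, Q.lift_subset_lift]

theorem star_subset_star {E E' : Set (Euc d)} (hE : IsFace P E) (hE' : IsFace P E')
    (hG : G.1 ⊆ E) (h : E ⊆ E') : Q.star E ⊆ Q.star E' := by
  obtain ⟨g, rfl⟩ := Q.exists_lift_eq hE' (hG.trans h)
  rwa [Q.star_lift, Q.star_subset_iff hE hG]

theorem eq_or_eq_of_subsingleton [Subsingleton (Euc e)] (Q : QuotientPolytope P G e)
    {E : Set (Euc d)} (hE : IsFace P E) (hG : G.1 ⊆ E) : E = G.1 ∨ E = P := by
  obtain ⟨f, rfl⟩ := Q.exists_lift_eq hE hG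
  rcases f.1.eq_empty_or_nonempty with hf | hf
  · exact Or.inl ((congrArg Q.lift (Subtype.ext hf)).trans Q.lift_empty)
  · refine Or.inr (Q.lift_eq_self_iff.2 ?_)
    rw [Subsingleton.eq_univ_of_nonempty hf, Subsingleton.eq_univ_of_nonempty (hf.mono f.2.subset)]

theorem exists_lift_singleton_eq {v : Euc d} (hE : IsFace P (convexHull ℝ (insert v G.1)))
    (hG : Convex ℝ G.1) (hv : v ∉ G.1) : ∃ (p : Euc e) (hp : p ∈ vertices Q.carrier),
      Q.lift ⟨{p}, hp⟩ = convexHull ℝ (insert v G.1) := by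
  have hvE := subset_convexHull ℝ (insert v G.1)
  obtain ⟨f, hf⟩ := Q.exists_lift_eq hE ((subset_insert _ _).trans hvE)
  have hfne : f.1.Nonempty := by
    rw [nonempty_iff_ne_empty]
    intro h
    rw [show f = ⟨∅, isExposed_empty⟩ from Subtype.ext h, Q.lift_empty] at hf
    exact hv (hf ▸ hvE (mem_insert _ _))
  obtain ⟨p, hp, hpf⟩ := Q.isFullPolytope.exists_vertex_mem f.2 hfne
  set K := Q.lift ⟨{p}, hp⟩ with hK
  have hKE : K ⊆ convexHull ℝ (insert v G.1) :=
    hf ▸ Q.lift_subset_lift.2 (singleton_subset_iff.2 hpf)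
  have hKeq : K = convexHull ℝ (K ∩ insert v G.1) :=
    IsFace.eq_convexHull_inter ((Q.isFace_lift _).mono hE.subset hKE)
  have hvK : v ∈ K := by
    by_contra hvK
    rw [inter_insert_of_notMem hvK, inter_eq_right.2 (Q.subset_lift _), hG.convexHull_eq,
      ← Q.lift_empty, hK] at hKeq
    exact singleton_ne_empty p (congrArg Subtype.val (Q.lift_injective hKeq))
  exact ⟨p, hp, hKE.antisymm (hKeq ▸ convexHull_mono (subset_inter
    (insert_subset hvK (Q.subset_lift _)) Subset.rfl))⟩

theorem isStarVertex_iff (hP : Convex ℝ P) {v : Euc d} {p : Euc e}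
    (hE : IsFace P (convexHull ℝ (insert v G.1))) :
    Q.IsStarVertex v p ↔
      ∃ hp : p ∈ vertices Q.carrier, Q.lift ⟨{p}, hp⟩ = convexHull ℝ (insert v G.1) := by
  have hvE : insert v G.1 ⊆ convexHull ℝ (insert v G.1) := subset_convexHull ℝ _
  have hmin : ∀ E, IsFace P E → G.1 ⊆ E → v ∈ E → convexHull ℝ (insert v G.1) ⊆ E :=
    fun E hE hGE hv => convexHull_min (insert_subset hv hGE) (hE.convex hP)
  constructor
  · rintro ⟨⟨_, hp⟩, rfl, hf, hle⟩
    refine ⟨hp, Subset.antisymm ?_ (hmin _ (Q.isFace_lift _) (Q.subset_lift _) hf.2)⟩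
    exact hle (a := ⟨_, hE⟩) ⟨(subset_insert _ _).trans hvE, hvE (mem_insert _ _)⟩
  · rintro ⟨hp, hlift⟩
    exact ⟨⟨{p}, hp⟩, rfl, ⟨Q.subset_lift _, hlift.ge (hvE (mem_insert _ _))⟩,
      fun E hE => hlift.le.trans (hmin _ E.2 hE.1 hE.2)⟩

theorem isStarVertex_of_subsingleton [Subsingleton (Euc e)] {v : Euc d} (hv : v ∈ P)
    (hvG : v ∉ G.1) (p : Euc e) : Q.IsStarVertex v p := by
  refine ⟨⟨Q.carrier, IsExposed.refl _⟩, ?_, ⟨Q.subset_lift _, Q.lift_self.ge hv⟩, fun E hE => ?_⟩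
  · exact (Subsingleton.eq_univ_of_nonempty Q.isFullPolytope.nonempty).trans
      (Subsingleton.eq_univ_of_nonempty (singleton_nonempty p)).symm
  · rcases Q.eq_or_eq_of_subsingleton E.2 hE.1 with h | h
    · exact absurd (h ▸ hE.2) hvG
    · exact Q.lift_self.le.trans h.ge

end QuotientPolytope

theorem monotoneOn_star {m i : ℕ} {Φ : ℕ → Set (Euc d)} (him : i ≤ m)
    (hΦ : Monotone Φ) (hface : ∀ j ≤ m, IsFace P (Φ j)) {hG : IsFace P (Φ i)}
    (Q : QuotientPolytope P ⟨Φ i, hG⟩ e) :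
    MonotoneOn (fun j => Q.star (Φ (i + j))) (Iic (m - i)) := by
  intro j hj k hk hjk
  rw [mem_Iic] at hj hk
  exact Q.star_subset_star (hface _ (by omega)) (hface _ (by omega)) (hΦ (Nat.le_add_right i j))
    (hΦ (Nat.add_le_add_left hjk i))

theorem level_lift {m i : ℕ} {Φ : ℕ → Set (Euc d)} (hi : 1 ≤ i) (him : i ≤ m)
    (hΦ : Monotone Φ) (hface : ∀ j ≤ m, IsFace P (Φ j)) {hG : IsFace P (Φ i)}
    (Q : QuotientPolytope P ⟨Φ i, hG⟩ e) (f : Face Q.carrier) :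
    level m Φ (Q.lift f) = i + level (m - i) (fun j => Q.star (Φ (i + j))) f.1 := by
  set Ψ : ℕ → Set (Euc e) := fun j => Q.star (Φ (i + j))
  have hΨ : MonotoneOn Ψ (Iic (m - i)) := monotoneOn_star him hΦ hface Q
  have hlevel {j : ℕ} (hj : 1 ≤ j) (hjm : j ≤ m - i) :
      i + j ≤ level m Φ (Q.lift f) ↔ j ≤ level (m - i) Ψ f.1 := by
    rw [le_level_iff (hΦ.monotoneOn _) (by omega) (by omega), le_level_iff hΨ hj hjm,
      Q.star_subset_iff (hface _ (by omega)) (hΦ (Nat.le_add_right i j))]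
  have hi' : i ≤ level m Φ (Q.lift f) :=
    (le_level_iff (hΦ.monotoneOn _) hi him).2 (Q.subset_lift f)
  have h₁ : level m Φ (Q.lift f) ≤ m := level_le
  have h₂ : level (m - i) Ψ f.1 ≤ m - i := level_le
  have h₃ := @hlevel (level m Φ (Q.lift f) - i)
  have h₄ := @hlevel (level (m - i) Ψ f.1)
  omega

end Quotient

section SewnCodes

variable {d e : ℕ} {P A B K : Set (Euc d)} {v z : Euc d}

theorem IsFullPolytope.inHorizon_convexHull (hP : IsFullPolytope P) (h : InHorizon P z A) :
    InHorizon P z (convexHull ℝ A) := by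
  obtain ⟨⟨F, hF, hAF, hz⟩, F', hF', hAF', hz'⟩ := h
  exact ⟨⟨F, hF, convexHull_min hAF (hF.1.convex hP.convex), hz⟩,
    F', hF', convexHull_min hAF' (hF'.1.convex hP.convex), hz'⟩

theorem IsSimplicial.isFace_convexHull_of_inHorizon (hS : IsSimplicial P) (hP : IsFullPolytope P)
    (hA : A ⊆ vertices P) (h : InHorizon P z A) : IsFace P (convexHull ℝ A) := by
  obtain ⟨⟨F, hF, hAF, -⟩, -⟩ := h
  exact hS.isFace_convexHull hP hF.1 (ne_of_mem_facets hF) hAF hA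

theorem IsSimplicial.isFace_convexHull_insert (hS : IsSimplicial P) (hP : IsFullPolytope P)
    (hA : A ⊆ vertices P) (h : InHorizon P z A) :
    IsFace (sewn P z) (convexHull ℝ (insert z (convexHull ℝ A))) ∧
      convexHull ℝ (insert z (convexHull ℝ A)) ∩ vertices P = A := by
  obtain ⟨hface, hinter⟩ := (hP.inHorizon_convexHull h).isFace_convexHull_insert hP
    (hS.isFace_convexHull_of_inHorizon hP hA h)
  refine ⟨hface, ?_⟩
  rw [← inter_eq_right.2 (vertices_subset (R := P)), ← inter_assoc, hinter,
    hP.convexHull_inter_vertices_eq hA]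

/-- The traces on the vertices of `P` of the faces of `[P, z]` that contain `z`, for a simplicial
polytope `P`; see `mem_sewnCodes_iff`. -/
def sewnCodes (P : Set (Euc d)) (z : Euc d) : Set (Set (Euc d)) :=
  insert (vertices P) {A | A ⊆ vertices P ∧ InHorizon P z A}

theorem mem_sewnCodes_iff (hP : IsFullPolytope P) (hS : IsSimplicial P) (hz : z ∉ P)
    (hgen : ∀ F ∈ facets P, IsBeyond P F z ∨ IsBeneath P F z) :
    A ∈ sewnCodes P z ↔ ∃ K, IsFace (sewn P z) K ∧ z ∈ K ∧ K ∩ vertices P = A := by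
  constructor
  · rintro (rfl | ⟨hA, h⟩)
    · exact ⟨sewn P z, IsExposed.refl _, mem_sewn,
        inter_eq_right.2 (vertices_subset.trans subset_sewn)⟩
    · obtain ⟨hface, hinter⟩ := hS.isFace_convexHull_insert hP hA h
      exact ⟨_, hface, subset_convexHull ℝ _ (mem_insert _ _), hinter⟩
  · rintro ⟨K, hK, hzK, rfl⟩
    by_cases hKP : K = sewn P z
    · exact Or.inl (hKP ▸ inter_eq_right.2 (vertices_subset.trans subset_sewn))
    · exact Or.inr ⟨inter_subset_right, (hP.inHorizon_inter hz hgen hK hzK hKP).mono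
        (inter_subset_inter_right _ vertices_subset)⟩

theorem IsFace.subset_iff_inter_vertices (hP : IsFullPolytope P) (hK : IsFace (sewn P z) K)
    {C : Set (Euc d)} (hC : Convex ℝ C) (hzC : z ∈ C) : K ⊆ C ↔ K ∩ vertices P ⊆ C := by
  rw [hK.subset_iff_of_sewn hC, hP.face_subset_iff hK.inter_of_sewn hC]
  exact ⟨fun h v hv => h.2 v hv.2 ⟨hv.1, vertices_subset hv.2⟩,
    fun h => ⟨fun _ => hzC, fun v hv hvK => h ⟨hvK.1, hv⟩⟩⟩

namespace QuotientPolytope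

variable {G : Face (sewn P z)} (Q : QuotientPolytope (sewn P z) G e)

/-- The embedding of the face lattice of a quotient of `[P, z]` by a face containing `z` into the
sets of vertices of `P`. -/
noncomputable def sewnCode (hP : IsFullPolytope P) (hz : z ∈ G.1) :
    Face Q.carrier ↪o Set (Euc d) :=
  OrderEmbedding.ofMapLEIff (fun K => Q.lift K ∩ vertices P) fun K K' => by
    rw [← Subtype.coe_le_coe, ← Q.lift_subset_lift,
      (Q.isFace_lift K).subset_iff_inter_vertices hP
        ((Q.isFace_lift K').convex (isFullPolytope_sewn hP z).convex) (Q.subset_lift K' hz)]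
    exact ⟨fun h => h.trans inter_subset_left, fun h => subset_inter h inter_subset_right⟩

theorem sewnCode_apply (hP : IsFullPolytope P) (hz : z ∈ G.1) (K : Face Q.carrier) :
    Q.sewnCode hP hz K = Q.lift K ∩ vertices P := rfl

theorem range_sewnCode (hP : IsFullPolytope P) (hS : IsSimplicial P) (hzP : z ∉ P)
    (hgen : ∀ F ∈ facets P, IsBeyond P F z ∨ IsBeneath P F z) (hB : B ⊆ vertices P)
    (hG : G.1 = convexHull ℝ (insert z (convexHull ℝ B))) (hz : z ∈ G.1) :
    range (Q.sewnCode hP hz) = {A ∈ sewnCodes P z | B ⊆ A} := by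
  have hBG : B ⊆ G.1 := hG ▸ (subset_convexHull ℝ B).trans
    ((subset_insert _ _).trans (subset_convexHull ℝ _))
  ext A
  rw [mem_ofPred_eq, mem_sewnCodes_iff hP hS hzP hgen]
  constructor
  · rintro ⟨K, rfl⟩
    exact ⟨⟨_, Q.isFace_lift K, Q.subset_lift K hz, rfl⟩,
      subset_inter (hBG.trans (Q.subset_lift K)) hB⟩
  · rintro ⟨⟨K, hK, hzK, rfl⟩, hBA⟩
    have hKc := hK.convex (isFullPolytope_sewn hP z).convex
    obtain ⟨f, rfl⟩ := Q.exists_lift_eq hK (hG ▸ convexHull_min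
      (insert_subset hzK (convexHull_min (hBA.trans inter_subset_left) hKc)) hKc)
    exact ⟨f, rfl⟩

theorem isStarVertex_of_sewnCode_eq (hP : IsFullPolytope P)
    (hG : G.1 = convexHull ℝ (insert z (convexHull ℝ B))) (hz : z ∈ G.1) {q : Euc e}
    (hq : q ∈ vertices Q.carrier) (hcode : Q.sewnCode hP hz ⟨{q}, hq⟩ = insert v B) :
    Q.IsStarVertex v q := by
  have hKc := (Q.isFace_lift ⟨{q}, hq⟩).convex (isFullPolytope_sewn hP z).convex
  have hsub := subset_convexHull ℝ (insert v G.1)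
  have hBG : B ⊆ G.1 := hG ▸ (subset_convexHull ℝ B).trans
    ((subset_insert _ _).trans (subset_convexHull ℝ _))
  rw [sewnCode_apply] at hcode
  have hlift : Q.lift ⟨{q}, hq⟩ = convexHull ℝ (insert v G.1) := by
    refine Subset.antisymm ?_ (convexHull_min (insert_subset ?_ (Q.subset_lift _)) hKc)
    · rw [(Q.isFace_lift _).subset_iff_inter_vertices hP (convex_convexHull ℝ _)
        (hsub (Or.inr hz)), hcode]
      exact (insert_subset_insert hBG).trans hsub
    · exact inter_subset_left (hcode.ge (mem_insert v B))
  exact (Q.isStarVertex_iff (isFullPolytope_sewn hP z).convex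
    (hlift ▸ Q.isFace_lift _)).2 ⟨hq, hlift⟩

end QuotientPolytope

end SewnCodes

/-- The point `z` is sewn onto the simplicial polytope `P` through the universal tower given by
`x` and `y`. -/
structure TowerSewing {d : ℕ} (P : Set (Euc d)) (m : ℕ) (x y : ℕ → Euc d) (z : Euc d) : Prop where
  polytope : IsFullPolytope P
  simplicial : IsSimplicial P
  two_mul_le : 2 * m ≤ d
  tower : IsUniversalTower P m x y
  beyond : IsExactlyBeyond P m (towerFace x y) z

section TowerSewing

variable {d m i : ℕ} {P A F : Set (Euc d)} {x y : ℕ → Euc d} {z : Euc d}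

theorem baseVertices_subset_towerVertices (hi : 1 ≤ i) :
    baseVertices x y i ⊆ towerVertices x y i :=
  insert_baseVertices (x := x) (y := y) hi ▸ subset_insert _ _

namespace TowerSewing

variable (h : TowerSewing P m x y z)
include h

theorem isBeyond_iff (hF : F ∈ facets P) : IsBeyond P F z ↔ Odd (level m (towerFace x y) F) :=
  h.beyond.isBeyond_iff (monotone_towerFace.monotoneOn _) hF

theorem isBeneath_iff (hF : F ∈ facets P) :
    IsBeneath P F z ↔ Even (level m (towerFace x y) F) :=
  h.beyond.isBeneath_iff (monotone_towerFace.monotoneOn _) hF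

theorem le_level_iff (hF : F ∈ facets P) (him : i ≤ m) :
    i ≤ level m (towerFace x y) F ↔ towerVertices x y i ⊆ F :=
  le_level_towerFace_iff (hF.1.convex h.polytope.convex) him

theorem notMem (hm : 1 ≤ m) : z ∉ P := by
  obtain ⟨F, hF, hlevel⟩ := h.tower.exists_facet_level_self h.polytope h.two_mul_le le_rfl hm
  exact ((h.isBeyond_iff hF).2 (hlevel ▸ odd_one)).notMem

theorem exists_even_add_level (n : ℕ) (hA : InHorizon P z A) :
    ∃ F ∈ facets P, A ⊆ F ∧ Even (n + level m (towerFace x y) F) := by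
  obtain ⟨⟨F, hF, hAF, hz⟩, F', hF', hAF', hz'⟩ := hA
  rw [h.isBeyond_iff hF] at hz
  rw [h.isBeneath_iff hF'] at hz'
  rcases n.even_or_odd with hn | hn
  · exact ⟨F', hF', hAF', hn.add hz'⟩
  · exact ⟨F, hF, hAF, hn.add_odd hz⟩

theorem inHorizon_of_odd_add_level {F' : Set (Euc d)} (hF : F ∈ facets P) (hAF : A ⊆ F)
    (hF' : F' ∈ facets P) (hAF' : A ⊆ F')
    (hodd : Odd (level m (towerFace x y) F + level m (towerFace x y) F')) : InHorizon P z A := by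
  rw [Nat.odd_add'] at hodd
  by_cases hlevel : Odd (level m (towerFace x y) F')
  · exact ⟨⟨F', hF', hAF', (h.isBeyond_iff hF').2 hlevel⟩,
      F, hF, hAF, (h.isBeneath_iff hF).2 (hodd.1 hlevel)⟩
  · refine ⟨⟨F, hF, hAF, (h.isBeyond_iff hF).2 ?_⟩,
      F', hF', hAF', (h.isBeneath_iff hF').2 (Nat.not_odd_iff_even.1 hlevel)⟩
    exact Nat.not_even_iff_odd.1 fun heven => hlevel (hodd.2 heven)

theorem exists_facet_level_eq_sub_one (hi : 1 ≤ i) (him : i ≤ m)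
    (hBA : baseVertices x y i ⊆ A) (hA : A ⊆ vertices P) (hy : y i ∉ A)
    (hface : IsFace P (convexHull ℝ A)) :
    ∃ F ∈ facets P, A ⊆ F ∧ level m (towerFace x y) F = i - 1 := by
  have hAh := subset_convexHull ℝ A
  have hsub : towerVertices x y (i - 1) ⊆ convexHull ℝ A :=
    ((subset_insert _ _).trans hBA).trans hAh
  have hsub' : ¬ towerVertices x y (i - 1 + 1) ⊆ convexHull ℝ A := by
    rw [Nat.sub_add_cancel hi, ← insert_baseVertices hi]
    exact fun hsub => hy (h.polytope.mem_of_mem_convexHull (hA.trans vertices_subset)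
      (h.tower.y_mem i ⟨hi, him⟩) (hsub (mem_insert _ _)))
  obtain ⟨F, hF, hAF, hlevel⟩ := h.tower.exists_facet_level_eq h.polytope hface
    ⟨x i, hAh (hBA (mem_insert _ _))⟩ (by omega) hsub hsub'
  exact ⟨F, hF, hAh.trans hAF, hlevel⟩

/-- Facets through the base of `Φ_i` that miss `y_i` all have level `i - 1`, so `z` lies on the
same side of all of them. -/
theorem inHorizon_iff (hi : 1 ≤ i) (him : i ≤ m) (hBA : baseVertices x y i ⊆ A)
    (hA : A ⊆ vertices P) (hy : y i ∉ A) :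
    InHorizon P z A ↔
      ∃ F ∈ facets P, insert (y i) A ⊆ F ∧ Even (i + level m (towerFace x y) F) := by
  constructor
  · intro hz
    obtain ⟨F, hF, hAF, heven⟩ := h.exists_even_add_level i hz
    have hlevel : i ≤ level m (towerFace x y) F := by
      have : i - 1 ≤ level m (towerFace x y) F :=
        (h.le_level_iff hF (by omega)).2 (((subset_insert _ _).trans hBA).trans hAF)
      have : level m (towerFace x y) F ≠ i - 1 := fun heq => by
        rw [heq] at heven
        exact Nat.not_even_iff_odd.2 ⟨i - 1, by omega⟩ heven
      omega
    refine ⟨F, hF, insert_subset ?_ hAF, heven⟩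
    exact (h.le_level_iff hF him).1 hlevel (insert_baseVertices hi ▸ mem_insert _ _)
  · rintro ⟨F, hF, hAF, heven⟩
    have hAF' := (subset_insert _ _).trans hAF
    obtain ⟨F', hF', hAF'', hlevel⟩ := h.exists_facet_level_eq_sub_one hi him hBA hA hy
      (h.simplicial.isFace_convexHull h.polytope hF.1 (ne_of_mem_facets hF) hAF' hA)
    refine h.inHorizon_of_odd_add_level hF hAF' hF' hAF'' ?_
    rw [hlevel, ← Nat.not_even_iff_odd]
    intro heven'
    have := heven.add heven'
    rw [Nat.even_iff] at this
    omega

theorem baseVertices_subset (hi : 1 ≤ i) (him : i ≤ m) : baseVertices x y i ⊆ vertices P :=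
  (baseVertices_subset_towerVertices hi).trans (h.tower.towerVertices_subset him)

theorem inHorizon_baseVertices (hi : 1 ≤ i) (him : i ≤ m) :
    InHorizon P z (baseVertices x y i) := by
  rw [h.inHorizon_iff hi him Subset.rfl (h.baseVertices_subset hi him)
    (h.tower.y_notMem_baseVertices hi him), insert_baseVertices hi]
  obtain ⟨F, hF, hlevel⟩ := h.tower.exists_facet_level_self h.polytope h.two_mul_le hi him
  exact ⟨F, hF, (h.le_level_iff hF him).1 hlevel.ge, hlevel ▸ Even.add_self _⟩

theorem isFace_convexHull_union_pair (hi : 1 ≤ i) (him : i ≤ m) :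
    IsFace (sewn P z) (convexHull ℝ (towerFace x y (i - 1) ∪ {x i, z})) ∧
      convexHull ℝ (towerFace x y (i - 1) ∪ {x i, z}) ∩ vertices P = baseVertices x y i := by
  rw [convexHull_union_pair_eq]
  exact h.simplicial.isFace_convexHull_insert h.polytope (h.baseVertices_subset hi him)
    (h.inHorizon_baseVertices hi him)

end TowerSewing

end TowerSewing

section QuotientSewing

variable {d e m i : ℕ} {P : Set (Euc d)} {x y : ℕ → Euc d} {z v : Euc d} {w p : Euc e}

/-- The trace of a face of `[R, z]` on `R`. -/
def traceFace (H : Face (sewn P z)) : Face P := ⟨H.1 ∩ P, H.2.inter_of_sewn⟩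

/-- The embedding of the face lattice of `[P/G, w]` into the sets of vertices of `P`, for a vertex
`u` of `G`: the vertices of `G` other than `u` belong to every code, and `u` stands for `w`. -/
noncomputable def QuotientPolytope.codeOfSewn {G : Face P} (Q : QuotientPolytope P G e)
    (hP : IsFullPolytope P) (w : Euc e) {u : Euc d} (hu : u ∈ vertices P) (huG : u ∈ G.1) :
    Face (sewn Q.carrier w) ↪o Set (Euc d) :=
  OrderEmbedding.ofMapLEIff
    (fun H => {v ∈ vertices P | v ∈ Q.lift (traceFace H) ∧ (v = u → w ∈ H.1)}) fun H K => by
      rw [← Subtype.coe_le_coe,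
        H.2.subset_iff_of_sewn (K.2.convex (isFullPolytope_sewn Q.isFullPolytope w).convex),
        show H.1 ∩ Q.carrier ⊆ K.1 ↔ (traceFace H).1 ⊆ (traceFace K).1 from
          ⟨fun h => subset_inter h inter_subset_right, fun h => h.trans inter_subset_left⟩,
        ← Q.lift_subset_lift,
        hP.face_subset_iff (Q.isFace_lift _) ((Q.isFace_lift _).convex hP.convex)]
      constructor
      · intro h
        refine ⟨fun hw => (h ⟨hu, Q.subset_lift _ huG, fun _ => hw⟩).2.2 rfl, fun v hv hvH => ?_⟩
        by_cases hvu : v = u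
        · exact Q.subset_lift _ (hvu ▸ huG)
        · exact (h ⟨hv, hvH, fun hvu' => absurd hvu' hvu⟩).2.1
      · rintro ⟨hw, hHK⟩ v ⟨hv, hvH, hvu⟩
        exact ⟨hv, hHK v hv hvH, fun heq => hw (hvu heq)⟩

/-- Besides the sewing of `z` onto `P`, the point `w` is sewn onto the quotient of `P` by a proper
level `Φ_i` of the tower, through the quotient tower. -/
structure QuotientSewing {hΦ : IsFace P (towerFace x y i)}
    (Q : QuotientPolytope P ⟨towerFace x y i, hΦ⟩ e) (m : ℕ) (z : Euc d) (w : Euc e) : Prop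
    extends TowerSewing P m x y z where
  one_le : 1 ≤ i
  lt : i < m
  beyond_quotient :
    IsExactlyBeyond Q.carrier (m - i) (fun j => Q.star (towerFace x y (i + j))) w

namespace QuotientSewing

variable {hΦ : IsFace P (towerFace x y i)} {Q : QuotientPolytope P ⟨towerFace x y i, hΦ⟩ e}
  (h : QuotientSewing Q m z w)
include h

theorem dim_pos : 0 < d := by
  have := h.two_mul_le
  have := h.lt
  omega

theorem towerVertices_subset : towerVertices x y i ⊆ vertices P :=
  h.tower.towerVertices_subset h.lt.le

theorem y_mem : y i ∈ vertices P := h.tower.y_mem i ⟨h.one_le, h.lt.le⟩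

theorem y_mem_towerVertices : y i ∈ towerVertices x y i := Or.inr ⟨i, ⟨h.one_le, le_rfl⟩, rfl⟩

theorem mem_towerFace_iff (hv : v ∈ vertices P) :
    v ∈ towerFace x y i ↔ v ∈ towerVertices x y i :=
  h.tower.mem_towerFace_iff h.polytope h.lt.le hv

theorem quotient_dim_pos : 0 < e := by
  rw [Nat.pos_iff_ne_zero]
  rintro rfl
  have hx : x (i + 1) ∈ towerFace x y (i + 1) :=
    subset_convexHull ℝ _ (Or.inr (mem_insert _ _))
  rcases Q.eq_or_eq_of_subsingleton (h.tower.isFace h.lt)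
    (monotone_towerFace (Nat.le_add_right i 1)) with heq | heq
  · exact h.tower.x_notMem i.lt_add_one h.lt ((h.mem_towerFace_iff
      (h.tower.x_mem _ ⟨by omega, h.lt⟩)).1 (heq.le hx))
  · exact h.tower.ne_polytope h.polytope h.two_mul_le h.lt heq

theorem monotoneOn_quotientTower :
    MonotoneOn (fun j => Q.star (towerFace x y (i + j))) (Iic (m - i)) :=
  monotoneOn_star h.lt.le monotone_towerFace (fun _ => h.tower.isFace) Q

theorem level_lift (f : Face Q.carrier) : level m (towerFace x y) (Q.lift f) =
    i + level (m - i) (fun j => Q.star (towerFace x y (i + j))) f.1 :=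
  Sewing.level_lift h.one_le h.lt.le monotone_towerFace (fun _ => h.tower.isFace) Q f

theorem lift_mem_facets_iff {f : Face Q.carrier} :
    Q.lift f ∈ facets P ↔ f.1 ∈ facets Q.carrier :=
  Q.lift_mem_facets_iff h.polytope h.dim_pos h.quotient_dim_pos

theorem exists_facet_lift_iff (q : ℕ → Prop) {g : Face Q.carrier} :
    (∃ F ∈ facets P, Q.lift g ⊆ F ∧ q (level m (towerFace x y) F)) ↔
      ∃ f ∈ facets Q.carrier, g.1 ⊆ f ∧
        q (i + level (m - i) (fun j => Q.star (towerFace x y (i + j))) f) := by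
  constructor
  · rintro ⟨F, hF, hgF, hq⟩
    obtain ⟨f, rfl⟩ := Q.exists_lift_eq hF.1 ((Q.subset_lift g).trans hgF)
    exact ⟨f.1, h.lift_mem_facets_iff.1 hF, Q.lift_subset_lift.1 hgF, h.level_lift f ▸ hq⟩
  · rintro ⟨f, hf, hgf, hq⟩
    exact ⟨Q.lift ⟨f, hf.1⟩, h.lift_mem_facets_iff.2 hf, Q.lift_subset_lift.2 hgf,
      (h.level_lift ⟨f, hf.1⟩).symm ▸ hq⟩

/-- Passing to the quotient lowers all levels by `i`, so for odd `i` it exchanges the two sides. -/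
theorem inHorizon_lift_iff {g : Face Q.carrier} :
    InHorizon P z (Q.lift g) ↔ InHorizon Q.carrier w g.1 := by
  rw [h.beyond.inHorizon_iff (monotone_towerFace.monotoneOn _),
    h.beyond_quotient.inHorizon_iff h.monotoneOn_quotientTower, h.exists_facet_lift_iff,
    h.exists_facet_lift_iff]
  rcases i.even_or_odd with hi | hi
  · simp only [hi, Nat.odd_add', Nat.even_add, iff_true, true_iff]
  · rw [and_comm]
    simp only [hi, Nat.odd_add, Nat.even_add, true_iff, Nat.not_even_iff_odd.2, false_iff,
      Nat.not_even_iff_odd]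

theorem exists_isBeyond_quotient : ∃ f ∈ facets Q.carrier, IsBeyond Q.carrier f w := by
  obtain ⟨F, hF, hlevel⟩ := h.tower.exists_facet_level_self h.polytope h.two_mul_le
    (Nat.le_add_left 1 i) h.lt
  have hΦF : towerFace x y i ⊆ F := by
    rw [towerFace_eq_convexHull]
    exact convexHull_min ((h.le_level_iff hF h.lt.le).1 (hlevel ▸ Nat.le_succ i))
      (hF.1.convex h.polytope.convex)
  obtain ⟨f, rfl⟩ := Q.exists_lift_eq hF.1 hΦF
  have hf := h.lift_mem_facets_iff.1 hF
  refine ⟨f.1, hf, (h.beyond_quotient.isBeyond_iff h.monotoneOn_quotientTower hf).2 ?_⟩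
  rw [h.level_lift, Nat.add_left_cancel_iff] at hlevel
  exact hlevel ▸ odd_one

theorem notMem_quotient : w ∉ Q.carrier :=
  let ⟨_, _, hw⟩ := h.exists_isBeyond_quotient
  hw.notMem

theorem baseVertices_subset : baseVertices x y i ⊆ vertices P :=
  h.toTowerSewing.baseVertices_subset h.one_le h.lt.le

theorem isBeneath_quotient_iff {f : Face Q.carrier} (hf : f.1 ∈ facets Q.carrier) :
    IsBeneath Q.carrier f.1 w ↔ Even (i + level m (towerFace x y) (Q.lift f)) := by
  rw [h.beyond_quotient.isBeneath_iff h.monotoneOn_quotientTower hf, h.level_lift, ← add_assoc,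
    Nat.even_add (m := i + i)]
  simp only [Even.add_self, true_iff]

/-- The embedding of the face lattice of `[P/Φ_i, w]` into the sets of vertices of `P` in which
`y_i` stands for `w`. -/
noncomputable def code : Face (sewn Q.carrier w) ↪o Set (Euc d) :=
  Q.codeOfSewn h.polytope w h.y_mem ((h.mem_towerFace_iff h.y_mem).2 h.y_mem_towerVertices)

theorem mem_code {H : Face (sewn Q.carrier w)} :
    v ∈ h.code H ↔ v ∈ vertices P ∧ v ∈ Q.lift (traceFace H) ∧ (v = y i → w ∈ H.1) := Iff.rfl

theorem code_subset_lift (H : Face (sewn Q.carrier w)) : h.code H ⊆ Q.lift (traceFace H) :=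
  fun _ hv => hv.2.1

theorem code_of_mem {H : Face (sewn Q.carrier w)} (hw : w ∈ H.1) :
    h.code H = Q.lift (traceFace H) ∩ vertices P := by
  ext v
  rw [h.mem_code]
  exact ⟨fun hv => ⟨hv.2.1, hv.1⟩, fun hv => ⟨hv.2, hv.1, fun _ => hw⟩⟩

theorem code_of_notMem {H : Face (sewn Q.carrier w)} (hw : w ∉ H.1) :
    h.code H = (Q.lift (traceFace H) ∩ vertices P) \ {y i} := by
  ext v
  rw [h.mem_code]
  exact ⟨fun hv => ⟨⟨hv.2.1, hv.1⟩, fun heq => hw (hv.2.2 heq)⟩,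
    fun hv => ⟨hv.1.2, hv.1.1, fun heq => absurd heq hv.2⟩⟩

theorem baseVertices_subset_code (H : Face (sewn Q.carrier w)) :
    baseVertices x y i ⊆ h.code H := fun v hv => by
  refine ⟨h.baseVertices_subset hv, Q.subset_lift _ ?_, fun heq => ?_⟩
  · exact (h.mem_towerFace_iff (h.baseVertices_subset hv)).2
      (baseVertices_subset_towerVertices h.one_le hv)
  · exact absurd (heq ▸ hv) (h.tower.y_notMem_baseVertices h.one_le h.lt.le)

theorem code_self : h.code ⟨sewn Q.carrier w, IsExposed.refl _⟩ = vertices P := by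
  have htrace : traceFace (⟨sewn Q.carrier w, IsExposed.refl _⟩ : Face _) =
      ⟨Q.carrier, IsExposed.refl _⟩ := Subtype.ext (inter_eq_right.2 subset_sewn)
  rw [h.code_of_mem mem_sewn, htrace, Q.lift_self, inter_eq_right.2 vertices_subset]

theorem code_mem_sewnCodes (H : Face (sewn Q.carrier w)) : h.code H ∈ sewnCodes P z := by
  have hQ := Q.isFullPolytope
  rcases eq_or_ne H.1 (sewn Q.carrier w) with hH | hH
  · rw [show H = ⟨sewn Q.carrier w, IsExposed.refl _⟩ from Subtype.ext hH, h.code_self]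
    exact Or.inl rfl
  refine Or.inr ⟨fun v hv => hv.1, ?_⟩
  by_cases hwH : w ∈ H.1
  · have hhor : InHorizon Q.carrier w (traceFace H).1 := hQ.inHorizon_inter h.notMem_quotient
      (fun F => h.beyond_quotient.isBeyond_or_isBeneath) H.2 hwH hH
    exact (h.inHorizon_lift_iff.2 hhor).mono (h.code_subset_lift H)
  · obtain ⟨f, hf, hHf, hfw⟩ := hQ.exists_isBeneath_of_notMem h.notMem_quotient H.2 hwH
    have hlift : Q.lift (traceFace H) ⊆ Q.lift ⟨f, hf.1⟩ :=
      Q.lift_subset_lift.2 (inter_subset_left.trans hHf)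
    have hy : y i ∉ h.code H := fun hy => hwH (hy.2.2 rfl)
    rw [h.toTowerSewing.inHorizon_iff h.one_le h.lt.le (h.baseVertices_subset_code H)
      (fun v hv => hv.1) hy]
    refine ⟨Q.lift ⟨f, hf.1⟩, h.lift_mem_facets_iff.2 hf, insert_subset ?_ ?_,
      (h.isBeneath_quotient_iff (f := ⟨f, hf.1⟩) hf).1 hfw⟩
    · exact Q.subset_lift _ ((h.mem_towerFace_iff h.y_mem).2 h.y_mem_towerVertices)
    · exact (h.code_subset_lift H).trans hlift

theorem exists_code_eq_of_mem (hA : A ⊆ vertices P) (hBA : baseVertices x y i ⊆ A)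
    (hhor : InHorizon P z A) (hy : y i ∈ A) : ∃ H, h.code H = A := by
  obtain ⟨g, hg⟩ := Q.exists_lift_eq
    (h.simplicial.isFace_convexHull_of_inHorizon h.polytope hA hhor)
    (towerFace_subset_convexHull (insert_baseVertices h.one_le ▸ insert_subset hy hBA))
  obtain ⟨hface, htrace⟩ := (h.inHorizon_lift_iff.1 (hg ▸ h.polytope.inHorizon_convexHull
    hhor)).isFace_convexHull_insert Q.isFullPolytope g.2
  refine ⟨⟨_, hface⟩, ?_⟩
  rw [h.code_of_mem (subset_convexHull ℝ _ (mem_insert w g.1)),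
    show traceFace ⟨_, hface⟩ = g from Subtype.ext htrace, hg,
    h.polytope.convexHull_inter_vertices_eq hA]

theorem exists_code_eq_of_notMem (hA : A ⊆ vertices P) (hBA : baseVertices x y i ⊆ A)
    (hhor : InHorizon P z A) (hy : y i ∉ A) : ∃ H, h.code H = A := by
  obtain ⟨F, hF, hAF, heven⟩ :=
    (h.toTowerSewing.inHorizon_iff h.one_le h.lt.le hBA hA hy).1 hhor
  have hA' : insert (y i) A ⊆ vertices P := insert_subset h.y_mem hA
  obtain ⟨g, hg⟩ := Q.exists_lift_eq
    (h.simplicial.isFace_convexHull h.polytope hF.1 (ne_of_mem_facets hF) hAF hA')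
    (towerFace_subset_convexHull (insert_baseVertices h.one_le ▸ insert_subset_insert hBA))
  have hgF : Q.lift g ⊆ F := hg ▸ convexHull_min hAF (hF.1.convex h.polytope.convex)
  obtain ⟨f, rfl⟩ := Q.exists_lift_eq hF.1 ((Q.subset_lift g).trans hgF)
  have hf := h.lift_mem_facets_iff.1 hF
  have hface : IsFace (sewn Q.carrier w) g.1 := Q.isFullPolytope.isFace_sewn_of_isBeneath g.2 hf
    (Q.lift_subset_lift.1 hgF) ((h.isBeneath_quotient_iff hf).2 heven)
  refine ⟨⟨g.1, hface⟩, ?_⟩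
  rw [h.code_of_notMem fun hw => h.notMem_quotient (g.2.subset hw),
    show traceFace ⟨g.1, hface⟩ = g from Subtype.ext (inter_eq_left.2 g.2.subset), hg,
    h.polytope.convexHull_inter_vertices_eq hA', insert_sdiff_self_of_notMem hy]

theorem range_code : range h.code = {A ∈ sewnCodes P z | baseVertices x y i ⊆ A} := by
  ext A
  constructor
  · rintro ⟨H, rfl⟩
    exact ⟨h.code_mem_sewnCodes H, h.baseVertices_subset_code H⟩
  · rintro ⟨rfl | ⟨hA, hhor⟩, hBA⟩
    · exact ⟨_, h.code_self⟩
    · by_cases hy : y i ∈ A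
      · exact h.exists_code_eq_of_mem hA hBA hhor hy
      · exact h.exists_code_eq_of_notMem hA hBA hhor hy

theorem isFace_convexHull_insert (hv : v ∈ vertices P) :
    IsFace P (convexHull ℝ (insert v (towerFace x y i))) :=
  h.tower.isFace_convexHull_insert h.two_mul_le h.one_le h.lt hv

theorem isStarVertex_iff (hv : v ∈ vertices P) : Q.IsStarVertex v p ↔
    ∃ hp : p ∈ vertices Q.carrier,
      Q.lift ⟨{p}, hp⟩ = convexHull ℝ (insert v (towerFace x y i)) :=
  Q.isStarVertex_iff h.polytope.convex (h.isFace_convexHull_insert hv)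

theorem exists_isStarVertex (hv : v ∈ vertices P \ towerVertices x y i) :
    ∃ p, Q.IsStarVertex v p := by
  obtain ⟨p, hp⟩ := Q.exists_lift_singleton_eq (h.isFace_convexHull_insert hv.1)
    convex_towerFace fun hvΦ => hv.2 ((h.mem_towerFace_iff hv.1).1 hvΦ)
  exact ⟨p, (h.isStarVertex_iff hv.1).2 hp⟩

theorem ne_of_isStarVertex (hv : v ∈ vertices P) (hp : Q.IsStarVertex v p) : p ≠ w := by
  obtain ⟨hp, -⟩ := (h.isStarVertex_iff hv).1 hp
  rintro rfl
  exact h.notMem_quotient (vertices_subset hp)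

theorem eq_of_isStarVertex {v' : Euc d} (hv : v ∈ vertices P \ towerVertices x y i)
    (hv' : v' ∈ vertices P) (hp : Q.IsStarVertex v p) (hp' : Q.IsStarVertex v' p) : v = v' := by
  obtain ⟨hp, hlift⟩ := (h.isStarVertex_iff hv.1).1 hp
  obtain ⟨_, hlift'⟩ := (h.isStarVertex_iff hv').1 hp'
  have hvE : v ∈ convexHull ℝ (insert v' (towerVertices x y i)) := by
    rw [← convexHull_insert_towerFace, ← hlift', hlift]
    exact subset_convexHull ℝ _ (mem_insert _ _)
  exact (h.polytope.mem_of_mem_convexHull ((insert_subset hv' h.towerVertices_subset).trans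
    vertices_subset) hv.1 hvE).resolve_right hv.2

/-- The least face containing `Φ_i` and a further vertex misses `x_{i+1}` or `y_{i+1}`, so it lies
in a facet of level `i`, and `w` is beneath the corresponding facet of the quotient. -/
theorem mem_vertices_sewn_of_isStarVertex (hv : v ∈ vertices P) (hp : Q.IsStarVertex v p) :
    p ∈ vertices (sewn Q.carrier w) := by
  obtain ⟨hp, hlift⟩ := (h.isStarVertex_iff hv).1 hp
  have hE := h.isFace_convexHull_insert hv
  rw [convexHull_insert_towerFace] at hlift hE
  have hEV := h.polytope.convexHull_inter_vertices_eq (insert_subset hv h.towerVertices_subset)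
  have hT := (subset_insert v _).trans (subset_convexHull ℝ (insert v (towerVertices x y i)))
  have hnot : ¬ towerVertices x y (i + 1) ⊆ convexHull ℝ (insert v (towerVertices x y i)) := by
    intro hsub
    have hsub' : towerVertices x y (i + 1) ⊆ insert v (towerVertices x y i) :=
      hEV ▸ subset_inter hsub (h.tower.towerVertices_subset h.lt)
    have hk : i + 1 ∈ Icc 1 (i + 1) := ⟨by omega, le_rfl⟩
    have hx := (hsub' (Or.inl ⟨_, hk, rfl⟩)).resolve_right (h.tower.x_notMem i.lt_add_one h.lt)
    have hy := (hsub' (Or.inr ⟨_, hk, rfl⟩)).resolve_right (h.tower.y_notMem i.lt_add_one h.lt)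
    exact h.tower.x_ne_y _ ⟨hk.1, h.lt⟩ _ ⟨hk.1, h.lt⟩ (hx.trans hy.symm)
  obtain ⟨F, hF, hEF, hlevel⟩ := h.tower.exists_facet_level_eq h.polytope hE
    ⟨v, subset_convexHull ℝ _ (mem_insert _ _)⟩ h.lt hT hnot
  rw [← hlift] at hEF
  obtain ⟨f, rfl⟩ := Q.exists_lift_eq hF.1 ((Q.subset_lift _).trans hEF)
  have hf := h.lift_mem_facets_iff.1 hF
  exact Q.isFullPolytope.isFace_sewn_of_isBeneath hp hf (Q.lift_subset_lift.1 hEF)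
    ((h.isBeneath_quotient_iff hf).2 (by rw [hlevel]; exact Even.add_self i))

theorem code_singleton_of_isStarVertex (hv : v ∈ vertices P \ towerVertices x y i)
    (hp : Q.IsStarVertex v p) :
    h.code ⟨{p}, h.mem_vertices_sewn_of_isStarVertex hv.1 hp⟩ =
      insert v (baseVertices x y i) := by
  have hpw : w ∉ ({p} : Set (Euc e)) := fun hw => h.ne_of_isStarVertex hv.1 hp hw.symm
  have hyv : y i ≠ v := ne_of_mem_of_not_mem h.y_mem_towerVertices hv.2
  have hsewn := h.mem_vertices_sewn_of_isStarVertex hv.1 hp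
  obtain ⟨hp, hlift⟩ := (h.isStarVertex_iff hv.1).1 hp
  rw [h.code_of_notMem hpw, show traceFace ⟨{p}, hsewn⟩ = ⟨{p}, hp⟩ from
      Subtype.ext (inter_eq_left.2 (singleton_subset_iff.2 (vertices_subset hp))), hlift,
    convexHull_insert_towerFace, h.polytope.convexHull_inter_vertices_eq
      (insert_subset hv.1 h.towerVertices_subset), ← insert_baseVertices h.one_le, insert_comm,
    insert_sdiff_self_of_notMem]
  rintro (heq | hy)
  · exact hyv heq
  · exact h.tower.y_notMem_baseVertices h.one_le h.lt.le hy

theorem mem_vertices_sewn : w ∈ vertices (sewn Q.carrier w) := by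
  obtain ⟨f, hf, hfw⟩ := h.exists_isBeyond_quotient
  obtain ⟨f', hf', hfw'⟩ := Q.isFullPolytope.exists_isBeneath h.notMem_quotient
  have hface := (InHorizon.isFace_convexHull_insert Q.isFullPolytope isExposed_empty
    ⟨⟨f, hf, empty_subset f, hfw⟩, f', hf', empty_subset f', hfw'⟩).1
  rwa [insert_empty_eq, convexHull_singleton] at hface

theorem code_singleton :
    h.code ⟨{w}, h.mem_vertices_sewn⟩ = insert (y i) (baseVertices x y i) := by
  have hV : towerFace x y i ∩ vertices P = towerVertices x y i := by
    rw [towerFace_eq_convexHull, h.polytope.convexHull_inter_vertices_eq h.towerVertices_subset]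
  have htrace : traceFace ⟨{w}, h.mem_vertices_sewn⟩ = ⟨∅, isExposed_empty⟩ :=
    Subtype.ext (singleton_inter_eq_empty.2 h.notMem_quotient)
  rw [h.code_of_mem (mem_singleton w), htrace, Q.lift_empty, insert_baseVertices h.one_le, hV]

theorem mem_vertices_sewn_iff : p ∈ vertices (sewn Q.carrier w) ↔
    p = w ∨ ∃ v ∈ vertices P \ towerVertices x y i, Q.IsStarVertex v p := by
  constructor
  · refine fun hp => or_iff_not_imp_left.2 fun hpw => ?_
    have hpQ : {p} ⊆ Q.carrier := IsFace.subset_of_sewn hp Q.isFullPolytope.convex (Ne.symm hpw)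
    have hp' : p ∈ vertices Q.carrier := (hp : IsFace _ _).mono subset_sewn hpQ
    obtain ⟨v, hv, hvE, hvΦ⟩ : ∃ v ∈ vertices P, v ∈ Q.lift ⟨{p}, hp'⟩ ∧ v ∉ towerFace x y i := by
      by_contra! hsub
      rw [← h.polytope.face_subset_iff (Q.isFace_lift _) convex_towerFace] at hsub
      exact singleton_ne_empty p (subset_empty_iff.1
        (Q.lift_subset_lift.1 (hsub.trans Q.lift_empty.ge)))
    have hv' : v ∈ vertices P \ towerVertices x y i :=
      ⟨hv, fun hvT => hvΦ ((h.mem_towerFace_iff hv).2 hvT)⟩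
    obtain ⟨q, hq⟩ := h.exists_isStarVertex hv'
    obtain ⟨hqv, hlift⟩ := (h.isStarVertex_iff hv).1 hq
    have hqp : ({q} : Set (Euc e)) ⊆ {p} := Q.lift_subset_lift.1 <| hlift.le.trans <|
      convexHull_min (insert_subset hvE (Q.subset_lift _))
        ((Q.isFace_lift _).convex h.polytope.convex)
    exact ⟨v, hv', singleton_subset_singleton.1 hqp ▸ hq⟩
  · rintro (rfl | ⟨v, hv, hp⟩)
    · exact h.mem_vertices_sewn
    · exact h.mem_vertices_sewn_of_isStarVertex hv.1 hp

theorem exists_isCombinatorialIso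
    {hG : IsFace (sewn P z) (convexHull ℝ (towerFace x y (i - 1) ∪ {x i, z}))} {e' : ℕ}
    (Q' : QuotientPolytope (sewn P z) ⟨_, hG⟩ e') :
    ∃ φ, IsCombinatorialIso (sewn Q.carrier w) Q'.carrier φ ∧
      (∀ v ∈ vertices P \ towerVertices x y i, ∀ p, Q.IsStarVertex v p →
        Q'.IsStarVertex v (φ p)) ∧ Q'.IsStarVertex (y i) (φ w) := by
  have hP := h.polytope
  have hGeq := convexHull_union_pair_eq x y i z
  have hzG : z ∈ convexHull ℝ (towerFace x y (i - 1) ∪ {x i, z}) :=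
    subset_convexHull ℝ _ (Or.inr (Or.inr rfl))
  obtain ⟨ψ, hψ⟩ := exists_orderIso_of_range_eq h.code (Q'.sewnCode hP hzG) <|
    h.range_code.trans (Q'.range_sewnCode hP h.simplicial (h.notMem (h.one_le.trans h.lt.le))
      (fun _ => h.beyond.isBeyond_or_isBeneath) h.baseVertices_subset hGeq hzG).symm
  obtain ⟨φ, hφ, hψφ⟩ :=
    Sewing.exists_isCombinatorialIso (isFullPolytope_sewn Q.isFullPolytope w) Q'.isFullPolytope ψ
  have hstar {v : Euc d} {p : Euc e} (hp : p ∈ vertices (sewn Q.carrier w))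
      (hcode : h.code ⟨{p}, hp⟩ = insert v (baseVertices x y i)) : Q'.IsStarVertex v (φ p) := by
    have hφp : φ p ∈ vertices Q'.carrier := hφ.1.mapsTo hp
    refine Q'.isStarVertex_of_sewnCode_eq hP hGeq hzG hφp ?_
    rw [← hcode, ← hψ]
    exact congrArg _ (Subtype.ext (hψφ p hp).symm)
  exact ⟨φ, hφ, fun v hv p hp => hstar _ (h.code_singleton_of_isStarVertex hv hp),
    hstar _ h.code_singleton⟩

end QuotientSewing

end QuotientSewing

end Sewing

open Sewing Set in
theorem theorem3p1_general {d e m : ℕ} {P : Set (Euc d)} (hP : IsFullPolytope P)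
    (hS : IsSimplicial P) (hmd : 2 * m ≤ d) {x y : ℕ → Euc d} (hT : IsUniversalTower P m x y)
    {z : Euc d} (hz : IsExactlyBeyond P m (towerFace x y) z) {i : ℕ} (hi : 1 ≤ i) (him : i ≤ m)
    (he : i = m → e = 0) :
    ∃ (hΦ : IsFace P (towerFace x y i))
      (hG : IsFace (sewn P z) (convexHull ℝ (towerFace x y (i - 1) ∪ {x i, z}))),
      ∀ (Q : QuotientPolytope P ⟨_, hΦ⟩ e) (Q' : QuotientPolytope (sewn P z) ⟨_, hG⟩ e) (w : Euc e),
        IsExactlyBeyond Q.carrier (m - i) (fun j => Q.star (towerFace x y (i + j))) w →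
        ∃ φ : Euc e → Euc e, IsCombinatorialIso (sewn Q.carrier w) Q'.carrier φ ∧
          (∀ p, p ∈ vertices (sewn Q.carrier w) ↔
            p = w ∨ ∃ v ∈ vertices P \ vertices (towerFace x y i), Q.IsStarVertex v p) ∧
          (i < m → ∀ v ∈ vertices P \ vertices (towerFace x y i), ∀ p, Q.IsStarVertex v p →
            p ≠ w ∧ ∀ u ∈ vertices P \ vertices (towerFace x y i), Q.IsStarVertex u p → u = v) ∧
          (∀ v ∈ vertices P \ vertices (towerFace x y i),
            ∃ p, Q.IsStarVertex v p ∧ Q'.IsStarVertex v (φ p)) ∧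
          Q'.IsStarVertex (y i) (φ w) := by
  have h : TowerSewing P m x y z := ⟨hP, hS, hmd, hT, hz⟩
  obtain ⟨hG, hGV⟩ := h.isFace_convexHull_union_pair hi him
  refine ⟨hT.isFace him, hG, fun Q Q' w hw => ?_⟩
  rw [hT.vertices_towerFace hP him]
  rcases him.eq_or_lt with rfl | hlt
  · obtain rfl := he rfl
    have hQ' : ∀ v ∈ vertices P \ baseVertices x y i, Q'.IsStarVertex v w := fun v hv =>
      Q'.isStarVertex_of_subsingleton (subset_sewn (vertices_subset hv.1))
        (fun hvG => hv.2 (hGV.le ⟨hvG, hv.1⟩)) w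
    have hne : (sewn Q.carrier w).Nonempty := ⟨w, mem_sewn⟩
    refine ⟨id, isCombinatorialIso_id_of_subsingleton hne Q'.isFullPolytope.nonempty,
      fun p => iff_of_true (mem_vertices_of_subsingleton hne p) (.inl (Subsingleton.elim p w)),
      fun hlt => absurd hlt (lt_irrefl _),
      fun v hv => ⟨w, ?_, hQ' v (sdiff_subset_sdiff_right ?_ hv)⟩,
      hQ' _ ⟨hT.y_mem i ⟨hi, le_rfl⟩, hT.y_notMem_baseVertices hi le_rfl⟩⟩
    · exact Q.isStarVertex_of_subsingleton (vertices_subset hv.1)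
        (fun hvΦ => hv.2 ((hT.mem_towerFace_iff hP le_rfl hv.1).1 hvΦ)) w
    · exact baseVertices_subset_towerVertices hi
  · have hQ : QuotientSewing Q m z w := ⟨h, hi, hlt, hw⟩
    obtain ⟨φ, hφ, hstar, hy⟩ := hQ.exists_isCombinatorialIso Q'
    refine ⟨φ, hφ, fun p => hQ.mem_vertices_sewn_iff, fun _ v hv p hp => ?_, fun v hv => ?_, hy⟩
    · exact ⟨hQ.ne_of_isStarVertex hv.1 hp, fun u hu hup => hQ.eq_of_isStarVertex hu hv.1 hup hp⟩
    · obtain ⟨p, hp⟩ := hQ.exists_isStarVertex hv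
      exact ⟨p, hp, hstar v hv p hp⟩

theorem theorem3p1 (m : ℕ) (hm : 1 < m) (P : Set (Sewing.Euc (2 * m)))
    (hP : Sewing.IsFullPolytope P) (hN : Sewing.IsNeighbourly P)
    (hcard : 2 * m + 3 ≤ (Sewing.vertices P).ncard)
    (x y : ℕ → Sewing.Euc (2 * m)) (hT : Sewing.IsUniversalTower P m x y)
    (xbar : Sewing.Euc (2 * m))
    (hx : Sewing.IsExactlyBeyond P m (Sewing.towerFace x y) xbar)
    (i : ℕ) (hi : 1 ≤ i) (him : i ≤ m) :
    ∃ (hΦ : Sewing.IsFace P (Sewing.towerFace x y i))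
      (hG : Sewing.IsFace (Sewing.sewn P xbar)
        (convexHull ℝ (Sewing.towerFace x y (i - 1) ∪ {x i, xbar}))),
      ∀ (Q : Sewing.QuotientPolytope P ⟨_, hΦ⟩ (2 * m - 2 * i))
        (Q' : Sewing.QuotientPolytope (Sewing.sewn P xbar) ⟨_, hG⟩ (2 * m - 2 * i))
        (ybar : Sewing.Euc (2 * m - 2 * i)),
        Sewing.IsExactlyBeyond Q.carrier (m - i)
          (fun j => Q.star (Sewing.towerFace x y (i + j))) ybar →
        ∃ φ : Sewing.Euc (2 * m - 2 * i) → Sewing.Euc (2 * m - 2 * i),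
          Sewing.IsCombinatorialIso (Sewing.sewn Q.carrier ybar) Q'.carrier φ ∧
          -- the vertices of the polytope sewn onto `Q` are the old ones `v*` and `ybar`
          (∀ p, p ∈ Sewing.vertices (Sewing.sewn Q.carrier ybar) ↔ p = ybar ∨
            ∃ v ∈ Sewing.vertices P \ Sewing.vertices (Sewing.towerFace x y i),
              Q.IsStarVertex v p) ∧
          -- below the top level they are pairwise distinct
          (i < m → ∀ v ∈ Sewing.vertices P \ Sewing.vertices (Sewing.towerFace x y i),
            ∀ p, Q.IsStarVertex v p → p ≠ ybar ∧
              ∀ w ∈ Sewing.vertices P \ Sewing.vertices (Sewing.towerFace x y i),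
                Q.IsStarVertex w p → w = v) ∧
          -- every old `v*` exists and is sent to `v**`
          (∀ v ∈ Sewing.vertices P \ Sewing.vertices (Sewing.towerFace x y i),
            ∃ p, Q.IsStarVertex v p ∧ Q'.IsStarVertex v (φ p)) ∧
          -- `ybar` is sent to `y_i**`
          Q'.IsStarVertex (y i) (φ ybar) :=
  theorem3p1_general hP (hN.isSimplicial hP (even_two_mul m)) le_rfl hT hx hi him
    fun h => by omega
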